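/- Let $k\ge 2$, $\mathcal X=\{1,\dots,k\}$, let $Q$ be a probability law on $\mathcal X$ with $Q(x)>0$ for all $x$, let $h:\mathcal X\to\mathbb R^d$ and $\alpha\in\mathbb R^d$, and let $$E=\Bigl\{P\in\mathbb R^k:\ P(x)>0\ \forall x,\ \sum_x P(x)=1,\ \sum_x P(x)h(x)=\alpha\Bigr\}.$$ Let $P^*$ be the information projection of $Q$ onto $E$, that is, $P^*\in E$ minimizes $D(P\|Q)=\sum_x P(x)\log\frac{P(x)}{Q(x)}$ over $P\in E$, and let $p^*_{\min}=\min_x P^*(x)$. Let $\mathsf T^*=\{v\in\mathbb R^k:\sum_x v_x=0,\ \sum_x v_x h(x)=0\}$ and $r=\dim\mathsf T^*$, let $\Pi_{\mathsf T^*}$ be the orthogonal projection of $\mathbb R^k$ onto $\mathsf T^*$, and let $H^*=\Pi_{\mathsf T^*}\,\mathrm{diag}(1/P^*)\,\Pi_{\mathsf T^*}$. Let $$\phi_{H^*}(v)=|H^*|^{1/2}(2\pi)^{-r/2}\exp\bigl(-\tfrac12 v^\top H^* v\bigr),\qquad v\in\mathsf T^*,$$ where $|H^*|$ is the determinant of $H^*$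 as an endomorphism of $\mathsf T^*$, and let $dv$ be Lebesgue measure on the Euclidean space $\mathsf T^*$. Assume that the integer vectors in $\mathsf T^*$ span $\mathsf T^*$ (for instance, that $h$ has rational values). Let $X_1,\dots,X_n$ be i.i.d. with law $Q$, and let $P_n$ be their empirical law. Whenever $E$ contains an empirical law of some sample of size $n$, and $m\le n$, let $$\mu_{n,m}(A)=\Pr\bigl((X_1,\dots,X_m)\in A\ \big|\ P_n\in E\bigr),\qquad A\subset\mathcal X^m.$$ For $v\in\mathsf T^*$ let $P(v)=\Pi(P^*+n^{-1/2}v)$, where $\Pi$ is the Euclidean nearest-point projection onto the closure of $E$, and let $P(v)^{\otimes m}$ be the law of $m$ independent draws from $P(v)$. There are constants $C_{\mathrm{geo}}$ and $L$, depending only on $k$, $d$, $p^*_{\min}$ and the matrix $H^*$, with the following property. For all $\eta<1/2$ and $K$ there is an $n_0$, depending only on these quantities and on $\eta$ and $K$, such that for all $n\ge n_0$ for which $E$ contains an empirical law of a sample of size $n$, all $m\le\min(n,Kn^{\eta})$ and all $A\subset\mathcal X^m$, $$\Bigl|\,\mu_{n,m}(A)-\int_{\mathsf T^*}P(v)^{\otimes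 m}(A)\,\phi_{H^*}(v)\,dv\,\Bigr|\ \le\ C_{\mathrm{geo}}\,n^{-1/2}(\log n)^{L},$$ and the integrand is integrable. -/

import Mathlib

open MeasureTheory

noncomputable section

namespace TiltedDeFinetti

/-- `ℝ^k` with its Euclidean structure; laws on `{1,…,k}` are vectors in it. -/
abbrev Vec (k : ℕ) : Type := EuclideanSpace ℝ (Fin k)

/-- The moment map `P ↦ A P = ∑ₓ P(x) h(x)`, where the columns of `A` are the features `h(x)`. -/
def moment {k d : ℕ} (h : Fin k → Fin d → ℝ) (P : Vec k) : Fin d → ℝ :=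
  ∑ x, P x • h x

/-- The open probability simplex. -/
def openSimplex (k : ℕ) : Set (Vec k) :=
  {P | (∀ x, 0 < P x) ∧ ∑ x, P x = 1}

/-- The feasible set `E` of strictly positive laws with moments `α`. -/
def feasible {k d : ℕ} (h : Fin k → Fin d → ℝ) (α : Fin d → ℝ) : Set (Vec k) :=
  {P | P ∈ openSimplex k ∧ moment h P = α}

/-- The closed version of `E`: all laws, possibly with zero weights, with moments `α`. -/
def closedFeasible {k d : ℕ} (h : Fin k → Fin d → ℝ) (α : Fin d → ℝ) : Set (Vec k) :=
  {P | (∀ x, 0 ≤ P x) ∧ ∑ x, P x = 1 ∧ moment h P = α}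

/-- The Kullback–Leibler divergence `D(P‖Q)` of strictly positive laws. -/
def klDivergence {k : ℕ} (P Q : Vec k) : ℝ :=
  ∑ x, P x * Real.log (P x / Q x)

/-- `Pstar` is the information projection of `Q` onto `E`. -/
def IsIProjection {k d : ℕ} (Q : Vec k) (h : Fin k → Fin d → ℝ) (α : Fin d → ℝ)
    (Pstar : Vec k) : Prop :=
  Pstar ∈ feasible h α ∧ ∀ P ∈ feasible h α, klDivergence Pstar Q ≤ klDivergence P Q

/-- The tangent space `T* = {v : 1ᵀ v = 0, A v = 0}`. -/
def tangentSpace {k d : ℕ} (h : Fin k → Fin d → ℝ) : Submodule ℝ (Vec k) where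
  carrier := {v | ∑ x, v x = 0 ∧ moment h v = 0}
  add_mem' := by
    rintro v w ⟨hv, hv'⟩ ⟨hw, hw'⟩
    simp only [moment] at hv' hw'
    constructor
    · simp [Finset.sum_add_distrib, hv, hw]
    · simp [moment, add_smul, Finset.sum_add_distrib, hv', hw']
  zero_mem' := by simp [moment]
  smul_mem' := by
    rintro c v ⟨hv, hv'⟩
    simp only [moment] at hv'
    constructor
    · simp [← Finset.mul_sum, hv]
    · simp [moment, mul_smul, ← Finset.smul_sum, hv']

/-- The integer vectors of `T*` span `T*`. These vectors are the differences of
vectors of counts with the same sample size and the same moments. The condition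
holds, for example, whenever `h` has rational values. -/
def HasFullTypeLattice {k d : ℕ} (h : Fin k → Fin d → ℝ) : Prop :=
  Submodule.span ℝ {v : Vec k | v ∈ tangentSpace h ∧ ∀ x, ∃ z : ℤ, v x = z} = tangentSpace h

/-- The ambient Hessian `diag(1/P)` of `P ↦ D(P‖Q)`. -/
def ambientHessian {k : ℕ} (P : Vec k) : Vec k →ₗ[ℝ] Vec k :=
  Matrix.toEuclideanLin (Matrix.diagonal fun x => 1 / P x)

/-- The orthogonal projection of `ℝ^k` onto `T*`, as an endomorphism of `ℝ^k`. -/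
def tangentProjection {k d : ℕ} (h : Fin k → Fin d → ℝ) : Vec k →ₗ[ℝ] Vec k :=
  ((tangentSpace h).starProjection : Vec k →L[ℝ] Vec k)

/-- The projected Hessian `H* = Π diag(1/P) Π` on `ℝ^k`, with `Π` the projection onto `T*`. -/
def projectedHessian {k d : ℕ} (h : Fin k → Fin d → ℝ) (P : Vec k) : Vec k →ₗ[ℝ] Vec k :=
  tangentProjection h ∘ₗ ambientHessian P ∘ₗ tangentProjection h

theorem projectedHessian_mem {k d : ℕ} (h : Fin k → Fin d → ℝ) (P v : Vec k) :
    projectedHessian h P v ∈ tangentSpace h :=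
  Submodule.starProjection_apply_mem _ _

/-- `H*` as an endomorphism of `T*`. -/
def tangentHessian {k d : ℕ} (h : Fin k → Fin d → ℝ) (P : Vec k) :
    tangentSpace h →ₗ[ℝ] tangentSpace h :=
  (projectedHessian h P).restrict fun v _ => projectedHessian_mem h P v

/-- The centred Gaussian density on `T*` with precision `H*`. -/
def gaussianDensity {k d : ℕ} (h : Fin k → Fin d → ℝ) (P : Vec k) (v : tangentSpace h) : ℝ :=
  Real.sqrt (LinearMap.det (tangentHessian h P)) *
    (2 * Real.pi) ^ (-(Module.finrank ℝ (tangentSpace h) : ℝ) / 2) *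
    Real.exp (-(1 / 2) * inner ℝ v (tangentHessian h P v))

/-- Lebesgue measure on the Euclidean space `T*`: the Haar measure that gives the unit cube
of an orthonormal basis measure one. -/
def tangentLebesgue {k d : ℕ} (h : Fin k → Fin d → ℝ) : Measure (tangentSpace h) :=
  (stdOrthonormalBasis ℝ (tangentSpace h)).toBasis.addHaar

/-- A point of `S` nearest to `y`; for `S` nonempty, closed and convex this is the
metric projection. -/
def nearestPoint {k : ℕ} (S : Set (Vec k)) (y : Vec k) : Vec k :=
  Classical.epsilon fun p => p ∈ S ∧ ∀ q ∈ S, ‖y - p‖ ≤ ‖y - q‖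

/-- The local chart `P(v) = Π(P* + n^{-1/2} v)`, with `Π` the metric projection onto the
closure of `E`, so that `P(v) = P* + n^{-1/2} v` as long as this is a law. -/
def localChart {k d : ℕ} (h : Fin k → Fin d → ℝ) (α : Fin d → ℝ) (Pstar : Vec k) (n : ℕ)
    (v : tangentSpace h) : Vec k :=
  nearestPoint (closedFeasible h α) (Pstar + (Real.sqrt n)⁻¹ • (v : Vec k))

/-- The probability `P^{⊗m}(A)` of `A` under `m` independent draws from `P`. -/
def iidProb {k : ℕ} (P : Vec k) (m : ℕ) (A : Set (Fin m → Fin k)) : ℝ :=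
  ∑ x : Fin m → Fin k, A.indicator (fun y => ∏ i, P (y i)) x

/-- The empirical law `P_n` of a sample of size `n`. -/
def empirical {k n : ℕ} (x : Fin n → Fin k) : Vec k :=
  WithLp.toLp 2 fun a => ((Finset.univ.filter fun i => x i = a).card : ℝ) / n

/-- The samples of size `n` whose empirical law lies in `E`. -/
def constraintEvent {k d : ℕ} (h : Fin k → Fin d → ℝ) (α : Fin d → ℝ) (n : ℕ) :
    Set (Fin n → Fin k) :=
  {x | empirical x ∈ feasible h α}

/-- The constrained predictive law `μ_{n,m}(A) = Pr(X_{1:m} ∈ A ∣ P_n ∈ E)`, where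
`X_1,…,X_n` are independent draws from `Q`. -/
def predictiveLaw {k d : ℕ} (Q : Vec k) (h : Fin k → Fin d → ℝ) (α : Fin d → ℝ)
    {n m : ℕ} (hmn : m ≤ n) (A : Set (Fin m → Fin k)) : ℝ :=
  iidProb Q n (constraintEvent h α n ∩ {x | (fun i => x (Fin.castLE hmn i)) ∈ A}) /
    iidProb Q n (constraintEvent h α n)

end TiltedDeFinetti

end

/-! By the first-order condition for the information projection, `log (P*/Q)` is orthogonal to `T*`,
so on the event `P_n ∈ E` the likelihood ratio of `Q` to `P*` is the constant `exp (-n D(P*‖Q))`,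
and `Q` may be replaced by `P*`. Given its vector of counts `N` the sample is exchangeable. Hence
`μ_{n,m}` is the average of the laws of `m` draws without replacement from populations with counts
`N`, over the positive integer vectors `N` in `n P* + T*`, weighted by the probabilities of `N`
under `P*`.

The integer points of `T*` form a lattice of full rank whose translated fundamental domains, scaled
by `n^{-1/2}`, tile `T*`, one cell for each `N`. With `R = log n` and `‖N - n P*‖ ≤ √n R`,
Stirling's formula identifies the weight of `N`, up to a factor `1 + O(R³/√n)` and a common
constant, with the Gaussian mass of its cell, and what lies outside this range is negligible. For
`v` in the cell of `N`, the laws of `m ≤ √n` draws without replacement from `N` and of `m`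
independent draws from `P* + n^{-1/2} v` differ by `O(m/n)`: the former is at least the product law
of `N/n` times `1 - O((χ² + m)/n)`, where the chi-square statistic `χ²` of the sample has mean
`O(m)`, and two laws differ on every set by at most the mass that such a lower bound loses. -/

noncomputable section

namespace TiltedDeFinetti

open Finset

theorem le_one_of_sum_eq_one {κ : Type*} [Fintype κ] {P : κ → ℝ} (hP0 : ∀ a, 0 ≤ P a)
    (hP1 : ∑ a, P a = 1) (a : κ) : P a ≤ 1 :=
  hP1 ▸ single_le_sum (fun b _ => hP0 b) (mem_univ a)

section Types

variable {κ : Type*} [DecidableEq κ] {m n : ℕ}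

/-- The vector of counts of a sample. -/
def typeCount (x : Fin n → κ) (a : κ) : ℕ := #{i | x i = a}

theorem typeCount_append {l : ℕ} (y : Fin m → κ) (z : Fin l → κ) :
    typeCount (Fin.append y z) = typeCount y + typeCount z := by
  funext b
  simp only [typeCount, card_filter, Fin.sum_univ_add, Pi.add_apply, Fin.append_left,
    Fin.append_right]

variable [Fintype κ]

theorem sum_typeCount (x : Fin n → κ) : ∑ a, typeCount x a = n := by
  simpa only [typeCount, card_fin] using
    (card_eq_sum_card_fiberwise fun i _ => mem_univ (x i) : #(univ : Finset (Fin n)) = _).symm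

theorem prod_comp_eq_prod_pow_typeCount {M : Type*} [CommMonoid M] (f : κ → M) (x : Fin n → κ) :
    ∏ i, f (x i) = ∏ a, f a ^ typeCount x a := by
  simp only [typeCount, ← prod_const, prod_fiberwise']

/-- The type class of `N`: the samples with vector of counts `N`. -/
def typeClass (n : ℕ) (N : κ → ℕ) : Finset (Fin n → κ) := {x | typeCount x = N}

theorem mem_typeClass {N : κ → ℕ} {x : Fin n → κ} : x ∈ typeClass n N ↔ typeCount x = N := by
  simp only [typeClass, mem_filter, mem_univ, true_and]

-- Compare the coefficients of `X ^ N` in two expansions of `(∑ a, X a) ^ n`.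
theorem card_typeClass {N : κ → ℕ} (hN : ∑ a, N a = n) :
    #(typeClass n N) = Nat.multinomial univ N := by
  set d : κ →₀ ℕ := Finsupp.equivFunOnFinite.symm N
  have hd : d.sum (fun _ c => c) = n := by
    rw [Finsupp.sum_fintype _ _ fun _ => rfl]
    exact hN
  have hindicator (x : Fin n → κ) :
      d = Finsupp.indicator univ (fun a _ => typeCount x a) ↔ typeCount x = N := by
    simp only [Finsupp.ext_iff, Finsupp.indicator_apply, mem_univ, dif_pos, funext_iff]
    exact forall_congr' fun _ => eq_comm
  have hcoeff := MvPolynomial.coeff_sum_X_pow_of_fintype (R := ℕ) d n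
  simp only [Fintype.sum_pow, prod_comp_eq_prod_pow_typeCount, MvPolynomial.coeff_sum,
    MvPolynomial.coeff_prod_X_pow, hindicator, if_pos hd] at hcoeff
  rw [typeClass, card_filter, hcoeff, Nat.cast_id,
    ← Finsupp.multinomial_of_support_subset (subset_univ _)]
  rfl

theorem typeClass_nonempty {N : κ → ℕ} (hN : ∑ a, N a = n) : (typeClass n N).Nonempty := by
  rw [← card_pos, card_typeClass hN]
  exact Nat.multinomial_pos ..

theorem card_filter_prefix_typeClass (hmn : m ≤ n) {N : κ → ℕ} {y : Fin m → κ}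
    (hy : typeCount y ≤ N) :
    #{x ∈ typeClass n N | x ∘ Fin.castLE hmn = y} = #(typeClass (n - m) (N - typeCount y)) := by
  obtain ⟨l, rfl⟩ := Nat.exists_eq_add_of_le hmn
  rw [Nat.add_sub_cancel_left]
  have hprefix (z : Fin l → κ) : Fin.append y z ∘ Fin.castLE hmn = y :=
    funext (Fin.append_left y z)
  refine (card_bij (fun z _ => Fin.append y z) (fun z hz => ?_)
    (fun z _ z' _ h => funext fun i => ?_) fun x hx => ?_).symm
  · rw [mem_typeClass] at hz
    rw [mem_filter, mem_typeClass, typeCount_append, hz, hprefix]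
    exact ⟨add_tsub_cancel_of_le hy, rfl⟩
  · simpa only [Fin.append_right] using congrFun h (Fin.natAdd m i)
  · obtain ⟨hN, rfl⟩ := mem_filter.1 hx
    have happend : Fin.append (x ∘ Fin.castLE hmn) (x ∘ Fin.natAdd m) = x :=
      Fin.append_castAdd_natAdd
    refine ⟨_, ?_, happend⟩
    rw [mem_typeClass] at hN ⊢
    rw [← hN]
    conv_rhs => rw [← happend, typeCount_append, hprefix, add_tsub_cancel_left]

/-- The probability of `A` under `m` draws without replacement from a population of size `n` with
composition `N`. It is encoded as the law of the first `m` letters of a uniform element of the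
type class of `N`. -/
def withoutReplacementProb (hmn : m ≤ n) (N : κ → ℕ) (A : Set (Fin m → κ)) : ℝ :=
  open Classical in #{x ∈ typeClass n N | x ∘ Fin.castLE hmn ∈ A} / #(typeClass n N)

section WithoutReplacement

variable (hmn : m ≤ n) {N : κ → ℕ}

theorem withoutReplacementProb_nonneg (A : Set (Fin m → κ)) :
    0 ≤ withoutReplacementProb hmn N A := by
  unfold withoutReplacementProb
  positivity

theorem withoutReplacementProb_le_one (A : Set (Fin m → κ)) :
    withoutReplacementProb hmn N A ≤ 1 := by
  classical
  exact div_le_one_of_le₀ (Nat.cast_le.2 (card_filter_le _ _)) (Nat.cast_nonneg _)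

theorem withoutReplacementProb_eq_sum (A : Set (Fin m → κ)) :
    withoutReplacementProb hmn N A =
      ∑ y, A.indicator (fun y => withoutReplacementProb hmn N {y}) y := by
  classical
  have hfiber : #{x ∈ typeClass n N | x ∘ Fin.castLE hmn ∈ A} =
      ∑ y with y ∈ A, #{x ∈ typeClass n N | x ∘ Fin.castLE hmn = y} := by
    rw [card_eq_sum_card_fiberwise (f := (· ∘ Fin.castLE hmn)) (t := {y | y ∈ A})
      fun x hx => by simpa using (mem_filter.1 hx).2]
    refine sum_congr rfl fun y hy => congrArg _ ?_
    rw [filter_filter]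
    exact filter_congr fun x _ => and_iff_right_of_imp fun h => h ▸ (mem_filter.1 hy).2
  simp only [withoutReplacementProb, Set.mem_singleton_iff, Set.indicator_apply]
  rw [← sum_filter, hfiber, Nat.cast_sum, sum_div]

theorem withoutReplacementProb_univ (hN : ∑ a, N a = n) :
    withoutReplacementProb hmn N Set.univ = 1 := by
  have hcard := card_pos.2 (typeClass_nonempty hN)
  simp only [withoutReplacementProb, Set.mem_univ, filter_true]
  exact div_self (by positivity)

theorem withoutReplacementProb_singleton (hN : ∑ a, N a = n) {y : Fin m → κ}
    (hy : typeCount y ≤ N) :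
    withoutReplacementProb hmn N {y} =
      (∏ a, ((N a).descFactorial (typeCount y a) : ℝ)) / n.descFactorial m := by
  have hrest : ∑ a, (N - typeCount y) a = n - m := by
    simp only [Pi.sub_apply]
    rw [sum_tsub_distrib _ fun a _ => hy a, hN, sum_typeCount]
  have hprod : ∏ a, (N a).factorial =
      (∏ a, ((N - typeCount y) a).factorial) * ∏ a, (N a).descFactorial (typeCount y a) := by
    rw [← prod_mul_distrib]
    exact prod_congr rfl fun a _ => (Nat.factorial_mul_descFactorial (hy a)).symm
  have hfull := Nat.multinomial_spec univ N
  have hpart := Nat.multinomial_spec univ (N - typeCount y)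
  rw [hN, hprod, ← Nat.factorial_mul_descFactorial hmn] at hfull
  rw [hrest] at hpart
  have hpos : 0 < ∏ a, ((N - typeCount y) a).factorial :=
    prod_pos fun a _ => Nat.factorial_pos _
  have hdesc : 0 < n.descFactorial m := Nat.descFactorial_pos.2 hmn
  have hcard : 0 < Nat.multinomial univ N := Nat.multinomial_pos ..
  simp only [withoutReplacementProb, Set.mem_singleton_iff]
  rw [card_filter_prefix_typeClass hmn hy, card_typeClass hrest, card_typeClass hN,
    div_eq_div_iff (by positivity) (by positivity)]
  norm_cast
  refine Nat.eq_of_mul_eq_mul_left hpos ?_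
  rw [← mul_assoc, hpart, ← mul_assoc, hfull]

end WithoutReplacement

end Types

section Weights

variable {κ : Type*}

/-- The deviation `N - n P` of a vector of counts from its mean under `n` independent draws from
`P`. -/
def countDeviation (P : EuclideanSpace ℝ κ) (n : ℕ) (N : κ → ℕ) : EuclideanSpace ℝ κ :=
  WithLp.toLp 2 (fun a => (N a : ℝ)) - (n : ℝ) • P

theorem countDeviation_apply (P : EuclideanSpace ℝ κ) (n : ℕ) (N : κ → ℕ) (a : κ) :
    countDeviation P n N a = N a - n * P a := rfl

variable [Fintype κ]

/-- The probability `n! / ∏ N_a! · ∏ P_a ^ N_a` of the type class of `N` under independent draws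
from `P`. -/
def typeWeight (P : EuclideanSpace ℝ κ) (N : κ → ℕ) : ℝ :=
  Nat.multinomial univ N * ∏ a, P a ^ N a

theorem typeWeight_pos {P : EuclideanSpace ℝ κ} (hP : ∀ a, 0 < P a) (N : κ → ℕ) :
    0 < typeWeight P N :=
  mul_pos (Nat.cast_pos.2 (Nat.multinomial_pos ..)) (prod_pos fun a _ => pow_pos (hP a) _)

variable [DecidableEq κ]

open Classical in
/-- The strictly positive vectors of counts of samples of size `n` that lie in `n P + T`. -/
def types (T : Submodule ℝ (EuclideanSpace ℝ κ)) (P : EuclideanSpace ℝ κ) (n : ℕ) :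
    Finset (κ → ℕ) :=
  {N ∈ piAntidiag univ n | (∀ a, 0 < N a) ∧ countDeviation P n N ∈ T}

variable {T : Submodule ℝ (EuclideanSpace ℝ κ)} {P : EuclideanSpace ℝ κ}

theorem mem_types {N : κ → ℕ} :
    N ∈ types T P n ↔ ∑ a, N a = n ∧ (∀ a, 0 < N a) ∧ countDeviation P n N ∈ T := by
  simp only [types, mem_filter, mem_piAntidiag, mem_univ, implies_true, and_true]

theorem card_types_le (T : Submodule ℝ (EuclideanSpace ℝ κ)) (P : EuclideanSpace ℝ κ) (n : ℕ) :
    #(types T P n) ≤ (n + 1) ^ Fintype.card κ := by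
  calc #(types T P n) ≤ #(Fintype.piFinset fun _ : κ => range (n + 1)) :=
        card_le_card fun N hN => by
          rw [Fintype.mem_piFinset]
          intro a
          rw [mem_range_succ_iff, ← (mem_types.1 hN).1]
          exact single_le_sum (fun _ _ => Nat.zero_le _) (mem_univ a)
    _ = (n + 1) ^ Fintype.card κ := by simp

end Weights

section Tilting

variable {k d m n : ℕ} {Q P R : Vec k} {h : Fin k → Fin d → ℝ} {α : Fin d → ℝ}

theorem mem_feasible_iff (hP : P ∈ feasible h α) :
    R ∈ feasible h α ↔ (∀ a, 0 < R a) ∧ R - P ∈ tangentSpace h := by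
  obtain ⟨⟨-, hPsum⟩, hPmoment⟩ := hP
  have hmoment : moment h (R - P) = moment h R - moment h P := by
    simp only [moment, PiLp.sub_apply, sub_smul, sum_sub_distrib]
  have hsum : ∑ a, (R - P) a = ∑ a, R a - ∑ a, P a := by
    simp only [PiLp.sub_apply, sum_sub_distrib]
  change ((_ ∧ _) ∧ _) ↔ _ ∧ (_ ∧ _)
  rw [hmoment, hsum, hPsum, hPmoment, sub_eq_zero, sub_eq_zero, and_assoc]

theorem mem_constraintEvent_iff (hP : P ∈ feasible h α) (hn : 0 < n) {x : Fin n → Fin k} :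
    x ∈ constraintEvent h α n ↔ typeCount x ∈ types (tangentSpace h) P n := by
  have hn' : (0 : ℝ) < n := Nat.cast_pos.2 hn
  have hdev : countDeviation P n (typeCount x) = (n : ℝ) • (empirical x - P) := by
    ext a
    change (typeCount x a : ℝ) - n * P a = n * (typeCount x a / n - P a)
    rw [mul_sub, mul_div_cancel₀ _ hn'.ne']
  have hpos (a : Fin k) : 0 < empirical x a ↔ 0 < typeCount x a := by
    change 0 < (typeCount x a : ℝ) / n ↔ _
    rw [div_pos_iff_of_pos_right hn', Nat.cast_pos]
  rw [constraintEvent, Set.mem_ofPred_eq, mem_feasible_iff hP, mem_types, hdev,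
    Submodule.smul_mem_iff _ hn'.ne']
  simp only [hpos, sum_typeCount, true_and]

theorem iidProb_constraintEvent_inter_eq_sum_types (hP : P ∈ feasible h α) (hn : 0 < n)
    (hmn : m ≤ n) (A : Set (Fin m → Fin k)) :
    iidProb P n (constraintEvent h α n ∩ {x | x ∘ Fin.castLE hmn ∈ A}) =
      ∑ N ∈ types (tangentSpace h) P n, typeWeight P N * withoutReplacementProb hmn N A := by
  classical
  simp only [iidProb, Set.indicator_apply]
  rw [← sum_filter, ← sum_fiberwise_of_maps_to (g := typeCount)
    fun x hx => (mem_constraintEvent_iff hP hn).1 (mem_filter.1 hx).2.1]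
  refine sum_congr rfl fun N hN => ?_
  have hNsum := (mem_types.1 hN).1
  have hcard : (0 : ℝ) < Nat.multinomial univ N := Nat.cast_pos.2 (Nat.multinomial_pos ..)
  rw [typeWeight, withoutReplacementProb, card_typeClass hNsum, mul_right_comm,
    mul_div_cancel₀ _ hcard.ne', ← nsmul_eq_mul, ← sum_const, filter_filter]
  refine sum_congr (ext fun x => ?_) fun x hx => ?_
  · simp only [mem_filter, mem_univ, true_and, Set.mem_inter_iff, Set.mem_ofPred_eq, mem_typeClass,
      mem_constraintEvent_iff hP hn]
    constructor
    · rintro ⟨⟨-, hA⟩, hx⟩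
      exact ⟨hx, hA⟩
    · rintro ⟨rfl, hA⟩
      exact ⟨⟨hN, hA⟩, rfl⟩
  · rw [prod_comp_eq_prod_pow_typeCount fun a => P a, mem_typeClass.1 (mem_filter.1 hx).1]

theorem hasDerivAt_klDivergence_add_smul (hQ : ∀ a, Q a ≠ 0) (hP : ∀ a, P a ≠ 0) (v : Vec k) :
    HasDerivAt (fun t : ℝ => klDivergence (P + t • v) Q)
      (∑ a, v a * Real.log (P a / Q a) + ∑ a, v a) 0 := by
  rw [← sum_add_distrib]
  refine HasDerivAt.fun_sum fun a _ => ?_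
  have hline : HasDerivAt (fun t : ℝ => (P + t • v) a) (v a) 0 := by
    simpa using ((hasDerivAt_id (0 : ℝ)).mul_const (v a)).const_add (P a)
  refine (hline.mul ((hline.div_const (Q a)).log ?_)).congr_deriv ?_
  · simp [hP a, hQ a]
  · simp only [zero_smul, add_zero]
    field_simp [hP a, hQ a]

theorem IsIProjection.sum_mul_log_eq_zero (hQ : Q ∈ openSimplex k) (hP : IsIProjection Q h α P)
    {v : Vec k} (hv : v ∈ tangentSpace h) : ∑ a, v a * Real.log (P a / Q a) = 0 := by
  have hpos : ∀ a, 0 < P a := hP.1.1.1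
  have hmin : IsLocalMin (fun t : ℝ => klDivergence (P + t • v) Q) 0 := by
    have hline : ∀ᶠ t : ℝ in nhds 0, ∀ a, 0 < (P + t • v) a := by
      refine Filter.eventually_all.2 fun a => ?_
      have hcont : Continuous fun t : ℝ => (P + t • v) a := by
        simp only [PiLp.add_apply, PiLp.smul_apply, smul_eq_mul]
        fun_prop
      exact hcont.continuousAt.eventually (lt_mem_nhds (by simpa using hpos a))
    filter_upwards [hline] with t ht
    simp only [zero_smul, add_zero]
    refine hP.2 _ ((mem_feasible_iff hP.1).2 ⟨ht, ?_⟩)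
    simpa only [add_sub_cancel_left] using Submodule.smul_mem _ t hv
  have hderiv := hmin.hasDerivAt_eq_zero (hasDerivAt_klDivergence_add_smul
    (fun a => (hQ.1 a).ne') (fun a => (hpos a).ne') v)
  rwa [hv.1, add_zero] at hderiv

theorem IsIProjection.prod_eq_exp_mul_prod (hQ : Q ∈ openSimplex k) (hP : IsIProjection Q h α P)
    (hn : 0 < n) {x : Fin n → Fin k} (hx : x ∈ constraintEvent h α n) :
    ∏ i, Q (x i) = Real.exp (-(n * klDivergence P Q)) * ∏ i, P (x i) := by
  have hdev : countDeviation P n (typeCount x) ∈ tangentSpace h :=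
    (mem_types.1 ((mem_constraintEvent_iff hP.1 hn).1 hx)).2.2
  have horth := hP.sum_mul_log_eq_zero hQ hdev
  have hlog : ∑ a, Real.log (P a / Q a) * typeCount x a = n * klDivergence P Q := by
    simp only [countDeviation_apply, sub_mul, sum_sub_distrib, mul_assoc, ← mul_sum] at horth
    simp only [mul_comm (Real.log _)]
    exact sub_eq_zero.1 horth
  rw [Real.exp_neg, eq_inv_mul_iff_mul_eq₀ (Real.exp_ne_zero _), ← hlog, Real.exp_sum,
    prod_comp_eq_prod_pow_typeCount fun a => P a, prod_comp_eq_prod_pow_typeCount fun a => Q a,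
    ← prod_mul_distrib]
  refine prod_congr rfl fun a _ => ?_
  rw [Real.exp_mul, Real.exp_log (div_pos (hP.1.1.1 a) (hQ.1 a)), Real.rpow_natCast, ← mul_pow,
    div_mul_cancel₀ _ (hQ.1 a).ne']

theorem IsIProjection.iidProb_constraintEvent_inter (hQ : Q ∈ openSimplex k)
    (hP : IsIProjection Q h α P) (hn : 0 < n) (S : Set (Fin n → Fin k)) :
    iidProb Q n (constraintEvent h α n ∩ S) =
      Real.exp (-(n * klDivergence P Q)) * iidProb P n (constraintEvent h α n ∩ S) := by
  rw [iidProb, iidProb, mul_sum]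
  refine sum_congr rfl fun x _ => ?_
  by_cases hx : x ∈ constraintEvent h α n ∩ S
  · rw [Set.indicator_of_mem hx, Set.indicator_of_mem hx, hP.prod_eq_exp_mul_prod hQ hn hx.1]
  · rw [Set.indicator_of_notMem hx, Set.indicator_of_notMem hx, mul_zero]

theorem IsIProjection.predictiveLaw_eq_sum_types (hQ : Q ∈ openSimplex k)
    (hP : IsIProjection Q h α P) (hn : 0 < n) (hmn : m ≤ n) (A : Set (Fin m → Fin k)) :
    predictiveLaw Q h α hmn A =
      (∑ N ∈ types (tangentSpace h) P n, typeWeight P N * withoutReplacementProb hmn N A) /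
        ∑ N ∈ types (tangentSpace h) P n, typeWeight P N := by
  have hnum := hP.iidProb_constraintEvent_inter hQ hn {x | x ∘ Fin.castLE hmn ∈ A}
  have hden : iidProb Q n (constraintEvent h α n) = Real.exp (-(n * klDivergence P Q)) *
      ∑ N ∈ types (tangentSpace h) P n, typeWeight P N := by
    have htotal := iidProb_constraintEvent_inter_eq_sum_types hP.1 hn hmn Set.univ
    have htilt := hP.iidProb_constraintEvent_inter hQ hn Set.univ
    simp only [Set.mem_univ, Set.ofPred_true, Set.inter_univ] at htotal htilt
    rw [htilt, htotal]
    exact congrArg _ (sum_congr rfl fun N hN => by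
      rw [withoutReplacementProb_univ hmn (mem_types.1 hN).1, mul_one])
  rw [iidProb_constraintEvent_inter_eq_sum_types hP.1 hn hmn] at hnum
  rw [predictiveLaw, hden]
  refine (congrArg (· / _) hnum).trans ?_
  rw [mul_div_mul_left _ _ (Real.exp_ne_zero _)]

end Tilting

section ProductLaw

variable {κ : Type*} [Fintype κ] {q q' u : κ → ℝ} (m : ℕ)

theorem sum_fin_succ_fun {M : Type*} [AddCommMonoid M] (F : (Fin (m + 1) → κ) → M) :
    ∑ y, F y = ∑ a, ∑ z : Fin m → κ, F (Fin.cons a z) := by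
  rw [← (Fin.consEquiv fun _ => κ).sum_comp, Fintype.sum_prod_type]
  rfl

theorem sum_prod_comp_eq_one (hq : ∑ a, q a = 1) : ∑ y : Fin m → κ, ∏ i, q (y i) = 1 := by
  rw [← Fintype.sum_pow, hq, one_pow]

theorem sum_prod_comp_mul_sum_eq_zero (hq : ∑ a, q a = 1) (hu : ∑ a, q a * u a = 0) :
    ∑ y : Fin m → κ, (∏ i, q (y i)) * ∑ i, u (y i) = 0 := by
  induction m with
  | zero => simp
  | succ m ih =>
    simp only [sum_fin_succ_fun, Fin.prod_univ_succ, Fin.sum_univ_succ, Fin.cons_zero,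
      Fin.cons_succ]
    calc
      _ = ∑ a, (q a * u a * ∑ z : Fin m → κ, ∏ i, q (z i) +
          q a * ∑ z : Fin m → κ, (∏ i, q (z i)) * ∑ i, u (z i)) := by
        refine sum_congr rfl fun a _ => ?_
        rw [mul_sum, mul_sum, ← sum_add_distrib]
        exact sum_congr rfl fun z _ => by ring
      _ = 0 := by simp only [ih, sum_prod_comp_eq_one m hq, mul_one, mul_zero, add_zero, hu]

theorem sum_prod_comp_mul_sum_sq (hq : ∑ a, q a = 1) (hu : ∑ a, q a * u a = 0) :
    ∑ y : Fin m → κ, (∏ i, q (y i)) * (∑ i, u (y i)) ^ 2 = m * ∑ a, q a * u a ^ 2 := by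
  induction m with
  | zero => simp
  | succ m ih =>
    simp only [sum_fin_succ_fun, Fin.prod_univ_succ, Fin.sum_univ_succ, Fin.cons_zero,
      Fin.cons_succ]
    calc
      _ = ∑ a, (q a * u a ^ 2 * ∑ z : Fin m → κ, ∏ i, q (z i) +
          2 * q a * u a * ∑ z : Fin m → κ, (∏ i, q (z i)) * ∑ i, u (z i) +
          q a * ∑ z : Fin m → κ, (∏ i, q (z i)) * (∑ i, u (z i)) ^ 2) := by
        refine sum_congr rfl fun a _ => ?_
        rw [mul_sum, mul_sum, mul_sum, ← sum_add_distrib, ← sum_add_distrib]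
        exact sum_congr rfl fun z _ => by ring
      _ = ∑ a, q a * u a ^ 2 + m * ∑ a, q a * u a ^ 2 := by
        simp only [ih, sum_prod_comp_eq_one m hq, sum_prod_comp_mul_sum_eq_zero m hq hu, mul_one,
          mul_zero, add_zero, sum_add_distrib, ← sum_mul, hq, one_mul]
      _ = (m + 1 : ℕ) * ∑ a, q a * u a ^ 2 := by
        push_cast
        ring

theorem sum_abs_prod_comp_sub_le (hq : ∑ a, q a = 1) (hq0 : ∀ a, 0 ≤ q a) (hq' : ∑ a, q' a = 1)
    (hq'0 : ∀ a, 0 ≤ q' a) :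
    ∑ y : Fin m → κ, |∏ i, q (y i) - ∏ i, q' (y i)| ≤ m * ∑ a, |q a - q' a| := by
  induction m with
  | zero => simp
  | succ m ih =>
    simp only [sum_fin_succ_fun, Fin.prod_univ_succ, Fin.cons_zero, Fin.cons_succ]
    have hstep (a : κ) (z : Fin m → κ) :
        |q a * ∏ i, q (z i) - q' a * ∏ i, q' (z i)| ≤
          |q a - q' a| * ∏ i, q (z i) + q' a * |∏ i, q (z i) - ∏ i, q' (z i)| := by
      rw [← abs_of_nonneg (prod_nonneg fun i _ => hq0 (z i)), ← abs_mul,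
        abs_of_nonneg (prod_nonneg fun i _ => hq0 (z i))]
      nth_rw 3 [← abs_of_nonneg (hq'0 a)]
      rw [← abs_mul]
      exact (congrArg _ (by ring)).trans_le (abs_add_le _ _)
    calc
      _ ≤ ∑ a, ∑ z : Fin m → κ, (|q a - q' a| * ∏ i, q (z i) +
          q' a * |∏ i, q (z i) - ∏ i, q' (z i)|) :=
        sum_le_sum fun a _ => sum_le_sum fun z _ => hstep a z
      _ = ∑ a, |q a - q' a| + ∑ z : Fin m → κ, |∏ i, q (z i) - ∏ i, q' (z i)| := by
        simp only [sum_add_distrib, ← mul_sum, sum_prod_comp_eq_one m hq, mul_one, ← sum_mul, hq',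
          one_mul]
      _ ≤ (m + 1 : ℕ) * ∑ a, |q a - q' a| := by
        push_cast
        linarith

variable [DecidableEq κ] {m}

/-- Pearson's chi-square statistic of a sample of size `m` for the law `q`. -/
def chiSquare (q : κ → ℝ) (y : Fin m → κ) : ℝ := ∑ a, (typeCount y a - m * q a) ^ 2 / q a

theorem chiSquare_nonneg (hq0 : ∀ a, 0 ≤ q a) (y : Fin m → κ) : 0 ≤ chiSquare q y :=
  sum_nonneg fun a _ => div_nonneg (sq_nonneg _) (hq0 a)

theorem chiSquare_eq_sum_sub (hq : ∑ a, q a = 1) (hq0 : ∀ a, q a ≠ 0) (y : Fin m → κ) :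
    chiSquare q y = ∑ a, (typeCount y a : ℝ) ^ 2 / q a - m ^ 2 := by
  have hcount : ∑ a, (typeCount y a : ℝ) = m := by exact_mod_cast sum_typeCount y
  have hterm (a : κ) : (typeCount y a - m * q a) ^ 2 / q a =
      (typeCount y a : ℝ) ^ 2 / q a - 2 * m * typeCount y a + m ^ 2 * q a := by
    field_simp [hq0 a]
    ring
  simp only [chiSquare, hterm, sum_add_distrib, sum_sub_distrib, ← mul_sum, hcount, hq]
  ring

theorem sum_prod_comp_mul_typeCount_sub_sq (hq : ∑ a, q a = 1) (a : κ) :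
    ∑ y : Fin m → κ, (∏ i, q (y i)) * (typeCount y a - m * q a) ^ 2 = m * (q a * (1 - q a)) := by
  have hmean : ∑ b, q b * ((if b = a then 1 else 0) - q a) = 0 := by
    simp [mul_sub, sum_sub_distrib, ← sum_mul, hq]
  have hvar : ∑ b, q b * ((if b = a then (1 : ℝ) else 0) - q a) ^ 2 = q a * (1 - q a) := by
    have hterm (b : κ) : q b * ((if b = a then (1 : ℝ) else 0) - q a) ^ 2 =
        (if b = a then q b * (1 - 2 * q a) else 0) + q b * q a ^ 2 := by
      split_ifs <;> ring
    simp only [hterm, sum_add_distrib, ← sum_mul, hq, sum_ite_eq', mem_univ, if_true]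
    ring
  rw [← hvar, ← sum_prod_comp_mul_sum_sq m hq hmean]
  refine sum_congr rfl fun y _ => ?_
  rw [sum_sub_distrib, sum_const, card_fin, nsmul_eq_mul, typeCount, card_filter]
  push_cast
  rfl

theorem sum_prod_comp_mul_chiSquare (hq : ∑ a, q a = 1) (hq0 : ∀ a, q a ≠ 0) :
    ∑ y : Fin m → κ, (∏ i, q (y i)) * chiSquare q y = m * (Fintype.card κ - 1) := by
  calc
    _ = ∑ a, (∑ y : Fin m → κ, (∏ i, q (y i)) * (typeCount y a - m * q a) ^ 2) / q a := by
      simp only [chiSquare, mul_sum, sum_div, mul_div_assoc]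
      exact sum_comm
    _ = ∑ a, m * (1 - q a) := by
      refine sum_congr rfl fun a _ => ?_
      rw [sum_prod_comp_mul_typeCount_sub_sq hq]
      field_simp [hq0 a]
    _ = m * (Fintype.card κ - 1) := by
      simp [← mul_sum, sum_sub_distrib, hq]

end ProductLaw

section IidProb

variable {k : ℕ} {P P' : Vec k}

theorem abs_iidProb_sub_le (hP : ∑ a, P a = 1) (hP0 : ∀ a, 0 ≤ P a) (hP' : ∑ a, P' a = 1)
    (hP'0 : ∀ a, 0 ≤ P' a) (m : ℕ) (A : Set (Fin m → Fin k)) :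
    |iidProb P m A - iidProb P' m A| ≤ m * ∑ a, |P a - P' a| := by
  refine le_trans ?_ (sum_abs_prod_comp_sub_le m hP hP0 hP' hP'0)
  rw [iidProb, iidProb, ← sum_sub_distrib]
  refine (abs_sum_le_sum_abs _ _).trans (sum_le_sum fun y _ => ?_)
  by_cases hy : y ∈ A <;> simp [hy]

theorem iidProb_nonneg (hP0 : ∀ a, 0 ≤ P a) (m : ℕ) (A : Set (Fin m → Fin k)) :
    0 ≤ iidProb P m A :=
  sum_nonneg fun y _ => Set.indicator_nonneg (fun z _ => prod_nonneg fun i _ => hP0 (z i)) y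

theorem iidProb_le_one (hP : ∑ a, P a = 1) (hP0 : ∀ a, 0 ≤ P a) (m : ℕ)
    (A : Set (Fin m → Fin k)) : iidProb P m A ≤ 1 := by
  rw [← sum_prod_comp_eq_one m hP]
  exact sum_le_sum fun y _ => Set.indicator_le_self' (f := fun y => ∏ i, P (y i))
    (fun z _ => prod_nonneg fun i _ => hP0 (z i)) y

end IidProb

section Sampling

theorem exp_neg_add_two_mul_sq_le {x : ℝ} (hx : x ≤ 1 / 2) :
    Real.exp (-(x + 2 * x ^ 2)) ≤ 1 - x := by
  rw [Real.exp_neg, inv_le_iff_one_le_mul₀ (Real.exp_pos _)]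
  calc (1 : ℝ) ≤ (1 - x) * (x + 2 * x ^ 2 + 1) := by nlinarith [sq_nonneg x]
    _ ≤ (1 - x) * Real.exp (x + 2 * x ^ 2) :=
      mul_le_mul_of_nonneg_left (Real.add_one_le_exp _) (by linarith)

theorem pow_mul_exp_le_descFactorial {N c : ℕ} (hN : 0 < N) (hc : 2 * c ≤ N) :
    (N : ℝ) ^ c * Real.exp (-((c : ℝ) ^ 2 / (2 * N) + 2 * (c : ℝ) ^ 3 / N ^ 2)) ≤
      N.descFactorial c := by
  have hN' : (0 : ℝ) < N := Nat.cast_pos.2 hN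
  induction c with
  | zero => simp
  | succ c ih =>
    have hfactor : N * Real.exp (-((c : ℝ) / N + 2 * ((c : ℝ) / N) ^ 2)) ≤ (N - c : ℕ) := by
      have hx : (c : ℝ) / N ≤ 1 / 2 := by
        rw [div_le_div_iff₀ hN' two_pos]
        exact_mod_cast (by omega : c * 2 ≤ 1 * N)
      have heq : ((N - c : ℕ) : ℝ) = N * (1 - c / N) := by
        rw [Nat.cast_sub (by omega), mul_sub, mul_one, mul_div_cancel₀ _ hN'.ne']
      rw [heq]
      exact mul_le_mul_of_nonneg_left (exp_neg_add_two_mul_sq_le hx) hN'.le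
    have hexponent : -(((c + 1 : ℕ) : ℝ) ^ 2 / (2 * N) + 2 * ((c + 1 : ℕ) : ℝ) ^ 3 / N ^ 2) ≤
        -((c : ℝ) / N + 2 * ((c : ℝ) / N) ^ 2) +
          -((c : ℝ) ^ 2 / (2 * N) + 2 * (c : ℝ) ^ 3 / N ^ 2) := by
      rw [← sub_nonneg]
      have hdiff : 0 ≤ 1 / (2 * N) + 2 * (2 * (c : ℝ) ^ 2 + 3 * c + 1) / N ^ 2 := by positivity
      refine hdiff.trans_eq ?_
      push_cast
      field_simp
      ring
    calc
      _ ≤ (N : ℝ) ^ (c + 1) * Real.exp (-((c : ℝ) / N + 2 * ((c : ℝ) / N) ^ 2) +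
          -((c : ℝ) ^ 2 / (2 * N) + 2 * (c : ℝ) ^ 3 / N ^ 2)) := by gcongr
      _ = (N * Real.exp (-((c : ℝ) / N + 2 * ((c : ℝ) / N) ^ 2))) *
          (N ^ c * Real.exp (-((c : ℝ) ^ 2 / (2 * N) + 2 * (c : ℝ) ^ 3 / N ^ 2))) := by
        rw [Real.exp_add]
        ring
      _ ≤ (N - c : ℕ) * (N.descFactorial c : ℝ) :=
        mul_le_mul hfactor (ih (by omega)) (by positivity) (Nat.cast_nonneg _)
      _ = N.descFactorial (c + 1) := by rw [Nat.descFactorial_succ, Nat.cast_mul]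

theorem descFactorial_le_pow_mul_exp {n : ℕ} (hn : 0 < n) (m : ℕ) (hmn : m ≤ n) :
    (n.descFactorial m : ℝ) ≤ (n : ℝ) ^ m * Real.exp (-(((m : ℝ) ^ 2 - m) / (2 * n))) := by
  have hn' : (0 : ℝ) < n := Nat.cast_pos.2 hn
  induction m with
  | zero => simp
  | succ m ih =>
    have hfactor : ((n - m : ℕ) : ℝ) ≤ n * Real.exp (-((m : ℝ) / n)) := by
      have heq : ((n - m : ℕ) : ℝ) = n * (-(m / n) + 1) := by
        rw [Nat.cast_sub (by omega)]
        field_simp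
        ring
      rw [heq]
      exact mul_le_mul_of_nonneg_left (Real.add_one_le_exp _) hn'.le
    have hexponent : -((m : ℝ) / n) + -(((m : ℝ) ^ 2 - m) / (2 * n)) =
        -((((m + 1 : ℕ) : ℝ) ^ 2 - (m + 1 : ℕ)) / (2 * n)) := by
      push_cast
      field_simp
      ring
    rw [Nat.descFactorial_succ, Nat.cast_mul]
    refine (mul_le_mul hfactor (ih (by omega)) (by positivity) (by positivity)).trans_eq ?_
    rw [mul_mul_mul_comm, ← Real.exp_add, hexponent, ← pow_succ']

theorem abs_sum_indicator_sub_le {ι : Type*} [Fintype ι] {μ ν δ : ι → ℝ}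
    (hμν : ∑ y, μ y = ∑ y, ν y) (hδ : ∀ y, 0 ≤ δ y) (h : ∀ y, ν y - δ y ≤ μ y) (A : Set ι) :
    |∑ y, A.indicator μ y - ∑ y, A.indicator ν y| ≤ ∑ y, δ y := by
  have hone_sided (A : Set ι) : ∑ y, A.indicator ν y - ∑ y, A.indicator μ y ≤ ∑ y, δ y := by
    rw [← sum_sub_distrib]
    refine sum_le_sum fun y _ => ?_
    by_cases hy : y ∈ A
    · simp only [hy, Set.indicator_of_mem]
      linarith [h y]
    · simpa [hy] using hδ y
  have hcompl (f : ι → ℝ) : ∑ y, Aᶜ.indicator f y = ∑ y, f y - ∑ y, A.indicator f y := by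
    rw [← sum_sub_distrib]
    exact sum_congr rfl fun y _ => congrFun (Set.indicator_compl A f) y
  have hAc := hone_sided Aᶜ
  rw [hcompl, hcompl] at hAc
  rw [abs_le]
  constructor <;> linarith [hone_sided A]

variable {κ : Type*} [Fintype κ] [DecidableEq κ] {m n : ℕ} {N : κ → ℕ}

theorem prod_mul_exp_le_withoutReplacementProb_singleton (hmn : m ≤ n) (hN : ∑ a, N a = n)
    (hn : 0 < n) (hN0 : ∀ a, 0 < N a) {y : Fin m → κ} (hy : ∀ a, 2 * typeCount y a ≤ N a) :
    (∏ i, (N (y i) : ℝ) / n) * Real.exp (((m : ℝ) ^ 2 - m) / (2 * n) -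
        ∑ a, ((typeCount y a : ℝ) ^ 2 / (2 * N a) + 2 * (typeCount y a : ℝ) ^ 3 / N a ^ 2)) ≤
      withoutReplacementProb hmn N {y} := by
  set S : ℝ := ∑ a, ((typeCount y a : ℝ) ^ 2 / (2 * N a) + 2 * (typeCount y a : ℝ) ^ 3 / N a ^ 2)
  set D : ℝ := ((m : ℝ) ^ 2 - m) / (2 * n)
  have hle : typeCount y ≤ N := fun a => (Nat.le_mul_of_pos_left _ two_pos).trans (hy a)
  have hdesc : (0 : ℝ) < n.descFactorial m := Nat.cast_pos.2 (Nat.descFactorial_pos.2 hmn)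
  have hprod : ∏ i, (N (y i) : ℝ) / n = (∏ a, (N a : ℝ) ^ typeCount y a) / n ^ m := by
    rw [prod_div_distrib, prod_comp_eq_prod_pow_typeCount fun a => (N a : ℝ), prod_const, card_fin]
  have hnum : (∏ a, (N a : ℝ) ^ typeCount y a) * Real.exp (-S) ≤
      ∏ a, ((N a).descFactorial (typeCount y a) : ℝ) := by
    rw [← sum_neg_distrib, Real.exp_sum, ← prod_mul_distrib]
    exact prod_le_prod (fun a _ => by positivity) fun a _ =>
      pow_mul_exp_le_descFactorial (hN0 a) (hy a)
  have hden : (n.descFactorial m : ℝ) ≤ (n : ℝ) ^ m * Real.exp (-D) :=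
    descFactorial_le_pow_mul_exp hn m hmn
  rw [withoutReplacementProb_singleton hmn hN hle, le_div_iff₀ hdesc, hprod]
  calc
    _ ≤ (∏ a, (N a : ℝ) ^ typeCount y a) / n ^ m * Real.exp (D - S) *
        ((n : ℝ) ^ m * Real.exp (-D)) := by gcongr
    _ = (∏ a, (N a : ℝ) ^ typeCount y a) * (Real.exp (D - S) * Real.exp (-D)) := by
      field_simp
    _ = (∏ a, (N a : ℝ) ^ typeCount y a) * Real.exp (-S) := by
      rw [← Real.exp_add]
      congr 2
      ring
    _ ≤ _ := hnum

variable {p : ℝ}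

theorem sum_sq_div_add_cube_div_le (hn : 0 < n) (hp : 0 < p) (hpN : ∀ a, p * n ≤ N a)
    (hm : m ^ 2 ≤ n) (y : Fin m → κ) :
    ∑ a, ((typeCount y a : ℝ) ^ 2 / (2 * N a) + 2 * (typeCount y a : ℝ) ^ 3 / N a ^ 2) ≤
      (∑ a, (typeCount y a : ℝ) ^ 2 / (N a / n)) / (2 * n) + 2 / p ^ 2 * (m / n) := by
  have hn' : (0 : ℝ) < n := Nat.cast_pos.2 hn
  have hcount : ∑ a, (typeCount y a : ℝ) = m := by exact_mod_cast sum_typeCount y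
  rw [← hcount, sum_div, sum_div, mul_sum, ← sum_add_distrib]
  refine sum_le_sum fun a _ => add_le_add (le_of_eq ?_) ?_
  · have hNa : (0 : ℝ) < N a := (mul_pos hp hn').trans_le (hpN a)
    field_simp
  · have hle : typeCount y a ≤ m := (card_filter_le _ _).trans_eq (card_fin m)
    have hcube : (typeCount y a : ℝ) ^ 3 ≤ n * typeCount y a := by
      rw [pow_succ]
      exact mul_le_mul_of_nonneg_right
        (by exact_mod_cast (Nat.pow_le_pow_left hle 2).trans hm) (Nat.cast_nonneg _)
    calc
      _ ≤ 2 * (n * typeCount y a) / (p * n) ^ 2 := by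
        gcongr
        exact hpN a
      _ = 2 / p ^ 2 * (typeCount y a / n) := by field_simp

theorem prod_mul_one_sub_le_withoutReplacementProb_singleton (hmn : m ≤ n) (hN : ∑ a, N a = n)
    (hn : 0 < n) (hp : 0 < p) (hpN : ∀ a, p * n ≤ N a) (hm : m ^ 2 ≤ n) (hmp : 2 * m ≤ p * n)
    (y : Fin m → κ) :
    (∏ i, (N (y i) : ℝ) / n) *
        (1 - (chiSquare (fun a => (N a : ℝ) / n) y / (2 * n) + (1 / 2 + 2 / p ^ 2) * (m / n))) ≤
      withoutReplacementProb hmn N {y} := by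
  have hn' : (0 : ℝ) < n := Nat.cast_pos.2 hn
  have hN0 (a : κ) : (0 : ℝ) < N a := (mul_pos hp hn').trans_le (hpN a)
  have hq : ∑ a, (N a : ℝ) / n = 1 := by
    rw [← sum_div, ← Nat.cast_sum, hN, div_self hn'.ne']
  have hy (a : κ) : 2 * typeCount y a ≤ N a := by
    have hle : typeCount y a ≤ m := (card_filter_le _ _).trans_eq (card_fin m)
    exact (Nat.mul_le_mul_left 2 hle).trans (by exact_mod_cast hmp.trans (hpN a))
  refine le_trans (mul_le_mul_of_nonneg_left ?_ (prod_nonneg fun i _ => by positivity))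
    (prod_mul_exp_le_withoutReplacementProb_singleton hmn hN hn
      (fun a => Nat.cast_pos.1 (hN0 a)) hy)
  refine le_trans ?_ (Real.add_one_le_exp _)
  rw [chiSquare_eq_sum_sub hq fun a => (div_pos (hN0 a) hn').ne']
  have hsum := sum_sq_div_add_cube_div_le hn hp hpN hm y
  have hsplit : ((m : ℝ) ^ 2 - m) / (2 * n) = m ^ 2 / (2 * n) - 1 / 2 * (m / n) := by
    field_simp
  rw [hsplit, sub_div]
  linarith

-- The chi-square statistic has mean `m (card κ - 1)` under independent draws, so the pointwise
-- lower bound loses only `O(m / n)` in total mass.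
theorem abs_withoutReplacementProb_sub_le (hmn : m ≤ n) (hN : ∑ a, N a = n) (hn : 0 < n)
    (hp : 0 < p) (hpN : ∀ a, p * n ≤ N a) (hm : m ^ 2 ≤ n) (hmp : 2 * m ≤ p * n)
    (A : Set (Fin m → κ)) :
    |withoutReplacementProb hmn N A -
        ∑ y, A.indicator (fun y => ∏ i, (N (y i) : ℝ) / n) y| ≤
      (Fintype.card κ / 2 + 2 / p ^ 2) * (m / n) := by
  have hn' : (0 : ℝ) < n := Nat.cast_pos.2 hn
  have hN0 (a : κ) : (0 : ℝ) < N a := (mul_pos hp hn').trans_le (hpN a)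
  set q : κ → ℝ := fun a => (N a : ℝ) / n
  have hq0 (a : κ) : 0 < q a := div_pos (hN0 a) hn'
  have hq : ∑ a, q a = 1 := by rw [← sum_div, ← Nat.cast_sum, hN, div_self hn'.ne']
  set δ : (Fin m → κ) → ℝ := fun y =>
    (∏ i, q (y i)) * (chiSquare q y / (2 * n) + (1 / 2 + 2 / p ^ 2) * (m / n))
  have hmass : ∑ y, withoutReplacementProb hmn N {y} = ∑ y : Fin m → κ, ∏ i, q (y i) := by
    rw [sum_prod_comp_eq_one m hq, ← withoutReplacementProb_univ hmn hN,
      withoutReplacementProb_eq_sum, Set.indicator_univ]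
  have hδ (y : Fin m → κ) : 0 ≤ δ y :=
    mul_nonneg (prod_nonneg fun i _ => (hq0 _).le) <|
      add_nonneg (div_nonneg (chiSquare_nonneg (fun a => (hq0 a).le) y) (by positivity))
        (by positivity)
  have hlower (y : Fin m → κ) : ∏ i, q (y i) - δ y ≤ withoutReplacementProb hmn N {y} :=
    (by ring : ∏ i, q (y i) - δ y = _).trans_le
      (prod_mul_one_sub_le_withoutReplacementProb_singleton hmn hN hn hp hpN hm hmp y)
  rw [withoutReplacementProb_eq_sum]
  refine (abs_sum_indicator_sub_le hmass hδ hlower A).trans_eq ?_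
  calc
    ∑ y, δ y = (∑ y : Fin m → κ, (∏ i, q (y i)) * chiSquare q y) / (2 * n) +
        (∑ y : Fin m → κ, ∏ i, q (y i)) * ((1 / 2 + 2 / p ^ 2) * (m / n)) := by
      simp only [δ, mul_add, sum_add_distrib, ← sum_mul, mul_div_assoc, sum_div]
    _ = (Fintype.card κ / 2 + 2 / p ^ 2) * (m / n) := by
      rw [sum_prod_comp_mul_chiSquare hq fun a => (hq0 a).ne', sum_prod_comp_eq_one m hq]
      field_simp
      ring

end Sampling

section Stirling

open InformationTheory

theorem log_sqrt_pi_le_log_stirlingSeq {N : ℕ} (hN : 0 < N) :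
    Real.log √Real.pi ≤ Real.log (Stirling.stirlingSeq N) :=
  Real.log_le_log (Real.sqrt_pos.2 Real.pi_pos) (Stirling.sqrt_pi_le_stirlingSeq hN.ne')

theorem log_stirlingSeq_le {N : ℕ} (hN : 0 < N) :
    Real.log (Stirling.stirlingSeq N) ≤ Real.log √Real.pi + 1 / (12 * N) := by
  let f : ℕ → ℝ := fun j => Real.log (Stirling.stirlingSeq (j + 1)) - 1 / (12 * (j + 1 : ℕ))
  have hmono : Monotone f := by
    refine monotone_nat_of_le_succ fun j => ?_
    have hstep := Stirling.log_stirlingSeq_sdiff_le (j + 1)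
    have htelescope : 1 / (12 * ((j + 1 : ℕ) : ℝ) * (((j + 1 : ℕ) : ℝ) + 1)) =
        1 / (12 * ((j + 1 : ℕ) : ℝ)) - 1 / (12 * ((j + 1 + 1 : ℕ) : ℝ)) := by
      push_cast
      field_simp
      ring
    simp only [f]
    linarith
  have hlim : Filter.Tendsto f Filter.atTop (nhds (Real.log √Real.pi - 0)) := by
    refine Filter.Tendsto.sub ?_ ?_
    · exact ((Filter.tendsto_add_atTop_iff_nat 1).2 Stirling.tendsto_stirlingSeq_sqrt_pi).log
        (Real.sqrt_pos.2 Real.pi_pos).ne'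
    · refine tendsto_const_nhds.div_atTop ?_
      exact ((Filter.tendsto_add_atTop_iff_nat 1).2 tendsto_natCast_atTop_atTop).const_mul_atTop
        (by norm_num)
  have hle : f (N - 1) ≤ _ := hmono.ge_of_tendsto hlim (N - 1)
  simp only [f, Nat.sub_add_cancel hN] at hle
  linarith

theorem abs_log_one_add_le {t : ℝ} (ht : |t| ≤ 1 / 2) : |Real.log (1 + t)| ≤ 2 * |t| := by
  have h := Real.abs_log_sub_add_sum_range_le (x := -t) (by rw [abs_neg]; linarith) 0
  simp only [range_zero, sum_empty, zero_add, sub_neg_eq_add, abs_neg, pow_one] at h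
  refine h.trans ?_
  rw [div_le_iff₀ (by linarith)]
  nlinarith [abs_nonneg t]

theorem abs_klFun_one_add_sub_le {t : ℝ} (ht : |t| ≤ 1 / 2) :
    |klFun (1 + t) - t ^ 2 / 2| ≤ 4 * |t| ^ 3 := by
  have ht0 := abs_nonneg t
  set e := -t + t ^ 2 / 2 + Real.log (1 + t) with he
  have htaylor : |e| ≤ 2 * |t| ^ 3 := by
    have h := Real.abs_log_sub_add_sum_range_le (x := -t) (by rw [abs_neg]; linarith) 2
    norm_num [sum_range_succ] at h
    refine h.trans ?_
    rw [div_le_iff₀ (by linarith)]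
    nlinarith [pow_nonneg ht0 3]
  have hsplit : klFun (1 + t) - t ^ 2 / 2 = (1 + t) * e - t ^ 3 / 2 := by
    rw [klFun_apply, he]
    ring
  have hone : |1 + t| ≤ 3 / 2 := by
    refine (abs_add_le _ _).trans ?_
    rw [abs_one]
    linarith
  calc
    _ ≤ |1 + t| * |e| + |t| ^ 3 / 2 := by
      rw [hsplit, ← abs_mul, ← abs_pow, ← abs_two (α := ℝ), ← abs_div, abs_two]
      exact abs_sub _ _
    _ ≤ 3 / 2 * (2 * |t| ^ 3) + |t| ^ 3 / 2 := by gcongr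
    _ ≤ 4 * |t| ^ 3 := by nlinarith [pow_nonneg ht0 3]

theorem sqrt_sub_one_sq_le_klFun {x : ℝ} (hx : 0 < x) : (√x - 1) ^ 2 ≤ klFun x := by
  have hs : 0 < √x := Real.sqrt_pos.2 hx
  have hlog : Real.log x = 2 * Real.log √x := by
    rw [Real.log_sqrt hx.le]
    ring
  have hmul : x * (1 - (√x)⁻¹) ≤ x * Real.log √x :=
    mul_le_mul_of_nonneg_left (Real.one_sub_inv_le_log_of_pos hs) hx.le
  have hself : x * (1 - (√x)⁻¹) = x - √x := by
    rw [mul_sub, mul_one, ← div_eq_mul_inv, Real.div_sqrt]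
  rw [klFun_apply, hlog, sub_sq, Real.sq_sqrt hx.le]
  linarith

theorem mul_sub_one_sq_le_klFun {x p : ℝ} (hx : 0 < x) (hp : p ≤ 1) (hpx : p * x ≤ 1) :
    p / 4 * (x - 1) ^ 2 ≤ klFun x := by
  have hsq : √x ^ 2 = x := Real.sq_sqrt hx.le
  have hcoeff : p * (√x + 1) ^ 2 ≤ 4 := by
    rcases le_or_gt p 0 with hp0 | hp0
    · exact (mul_nonpos_of_nonpos_of_nonneg hp0 (sq_nonneg _)).trans (by norm_num)
    · nlinarith [mul_nonneg hp0.le (sq_nonneg (√x - 1))]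
  calc
    p / 4 * (x - 1) ^ 2 = p * (√x + 1) ^ 2 / 4 * (√x - 1) ^ 2 := by
      nth_rw 1 [← hsq]
      ring
    _ ≤ (√x - 1) ^ 2 := mul_le_of_le_one_left (sq_nonneg _) (by linarith)
    _ ≤ klFun x := sqrt_sub_one_sq_le_klFun hx

/-- The amount by which the logarithm of the Poisson weight `e⁻ʸ y ^ N / N!` falls short of
`-log √(2πy)`, its approximate value at `N = y`. -/
def logPoissonDeficit (y : ℝ) (N : ℕ) : ℝ :=
  Real.log N.factorial - N * Real.log y + y - 1 / 2 * Real.log (2 * Real.pi * y)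

theorem logPoissonDeficit_eq {y : ℝ} (hy : 0 < y) {N : ℕ} (hN : 0 < N) :
    logPoissonDeficit y N = Real.log (Stirling.stirlingSeq N) - Real.log √Real.pi +
      1 / 2 * Real.log (N / y) + y * klFun (N / y) := by
  have hN' : (N : ℝ) ≠ 0 := Nat.cast_ne_zero.2 hN.ne'
  have hkl : y * klFun (N / y) = N * Real.log (N / y) + y - N := by
    rw [klFun_apply]
    field_simp
  rw [hkl, Stirling.log_stirlingSeq_formula, logPoissonDeficit, Real.log_div hN' hy.ne',
    Real.log_div hN' (Real.exp_pos 1).ne', Real.log_exp, Real.log_mul two_ne_zero hN',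
    Real.log_mul (by positivity) hy.ne', Real.log_mul two_ne_zero Real.pi_ne_zero,
    Real.log_sqrt Real.pi_pos.le]
  ring

theorem mul_sq_div_sub_le_logPoissonDeficit {y p : ℝ} (hy : 0 < y) (hp : p ≤ 1) {N : ℕ}
    (hN : 0 < N) (hpN : p * N ≤ y) :
    p / 4 * ((N - y) ^ 2 / y) - 1 / 2 * Real.log y ≤ logPoissonDeficit y N := by
  have hN1 : (1 : ℝ) ≤ N := Nat.one_le_cast.2 hN
  have hlog : -Real.log y ≤ Real.log (N / y) := by
    rw [Real.log_div (by positivity) hy.ne']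
    linarith [Real.log_nonneg hN1]
  have hkl : p / 4 * ((N - y) ^ 2 / y) ≤ y * klFun (N / y) := by
    have hpx : p * (N / y) ≤ 1 := by rwa [← mul_div_assoc, div_le_one hy]
    have heq : y * (p / 4 * ((N : ℝ) / y - 1) ^ 2) = p / 4 * ((N - y) ^ 2 / y) := by field_simp
    rw [← heq]
    exact mul_le_mul_of_nonneg_left (mul_sub_one_sq_le_klFun (by positivity) hp hpx) hy.le
  rw [logPoissonDeficit_eq hy hN]
  linarith [log_sqrt_pi_le_log_stirlingSeq hN]

theorem abs_logPoissonDeficit_sub_le {y B : ℝ} (hy : 0 < y) {N : ℕ} (hB : |N - y| ≤ B)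
    (hBy : 2 * B ≤ y) :
    |logPoissonDeficit y N - 1 / 2 * ((N - y) ^ 2 / y)| ≤ (1 + B) / y + 4 * B ^ 3 / y ^ 2 := by
  have hNy : y ≤ 2 * N := by linarith [(abs_le.1 hB).1]
  have hN : 0 < N := Nat.cast_pos.1 (by linarith : (0 : ℝ) < N)
  obtain ⟨t, ht⟩ : ∃ t : ℝ, N / y = 1 + t := ⟨N / y - 1, by ring⟩
  have hsub : N - y = y * t := by
    rw [div_eq_iff hy.ne'] at ht
    linarith
  have htB : |t| ≤ B / y := by
    rw [le_div_iff₀ hy, mul_comm, ← abs_of_pos hy, ← abs_mul, ← hsub]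
    exact hB
  have ht2 : |t| ≤ 1 / 2 := htB.trans (by rw [div_le_div_iff₀ hy two_pos]; linarith)
  have hstirling : |Real.log (Stirling.stirlingSeq N) - Real.log √Real.pi| ≤ 1 / y := by
    rw [abs_of_nonneg (sub_nonneg.2 (log_sqrt_pi_le_log_stirlingSeq hN))]
    have hinv : 1 / (12 * (N : ℝ)) ≤ 1 / y := one_div_le_one_div_of_le hy (by linarith)
    linarith [log_stirlingSeq_le hN]
  have hlog : |1 / 2 * Real.log (1 + t)| ≤ B / y := by
    rw [abs_mul, abs_of_pos one_half_pos]
    linarith [abs_log_one_add_le ht2]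
  have hkl : |y * (klFun (1 + t) - t ^ 2 / 2)| ≤ 4 * B ^ 3 / y ^ 2 := by
    rw [abs_mul, abs_of_pos hy]
    calc
      _ ≤ y * (4 * (B / y) ^ 3) := by
        gcongr
        exact (abs_klFun_one_add_sub_le ht2).trans (by gcongr)
      _ = 4 * B ^ 3 / y ^ 2 := by field_simp
  have hsplit : logPoissonDeficit y N - 1 / 2 * ((N - y) ^ 2 / y) =
      Real.log (Stirling.stirlingSeq N) - Real.log √Real.pi + 1 / 2 * Real.log (1 + t) +
        y * (klFun (1 + t) - t ^ 2 / 2) := by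
    rw [logPoissonDeficit_eq hy hN, hsub, ht]
    field_simp
    ring
  rw [hsplit, add_div]
  exact (abs_add_three _ _ _).trans (add_le_add_three hstirling hlog hkl)

end Stirling

section WeightBounds

variable {κ : Type*} [Fintype κ] {P : EuclideanSpace ℝ κ} {n : ℕ} {N : κ → ℕ}

/-- The logarithm of Stirling's approximation to `typeWeight P (n P)`. -/
def logCentralWeight (P : EuclideanSpace ℝ κ) (n : ℕ) : ℝ :=
  Real.log n.factorial - n * Real.log n + n - ∑ a, 1 / 2 * Real.log (2 * Real.pi * (n * P a))

theorem log_typeWeight (hP : ∀ a, 0 < P a) (hP1 : ∑ a, P a = 1) (hn : 0 < n)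
    (hN : ∑ a, N a = n) :
    Real.log (typeWeight P N) =
      logCentralWeight P n - ∑ a, logPoissonDeficit (n * P a) (N a) := by
  have hn' : (n : ℝ) ≠ 0 := Nat.cast_ne_zero.2 hn.ne'
  have hfact (a : κ) : ((N a).factorial : ℝ) ≠ 0 := Nat.cast_ne_zero.2 (Nat.factorial_ne_zero _)
  have hmult : (Nat.multinomial univ N : ℝ) ≠ 0 :=
    Nat.cast_ne_zero.2 (Nat.multinomial_pos univ N).ne'
  have hlogmult : Real.log n.factorial =
      ∑ a, Real.log (N a).factorial + Real.log (Nat.multinomial univ N) := by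
    rw [← hN, ← Nat.multinomial_spec, Nat.cast_mul, Nat.cast_prod,
      Real.log_mul (prod_ne_zero_iff.2 fun a _ => hfact a) hmult, Real.log_prod fun a _ => hfact a]
  have hterm (a : κ) : logPoissonDeficit (n * P a) (N a) = Real.log (N a).factorial -
      N a * Real.log (P a) - N a * Real.log n + n * P a -
        1 / 2 * Real.log (2 * Real.pi * (n * P a)) := by
    rw [logPoissonDeficit, Real.log_mul hn' (hP a).ne']
    ring
  rw [typeWeight, Real.log_mul hmult (prod_ne_zero_iff.2 fun a _ => pow_ne_zero _ (hP a).ne'),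
    Real.log_prod fun a _ => pow_ne_zero _ (hP a).ne', logCentralWeight, hlogmult]
  simp only [hterm, Real.log_pow, sum_add_distrib, sum_sub_distrib, ← sum_mul, ← mul_sum, hP1,
    ← Nat.cast_sum, hN]
  ring

variable {p : ℝ}

theorem typeWeight_le (hp : 0 < p) (hpP : ∀ a, p ≤ P a) (hP1 : ∑ a, P a = 1) (hn : 0 < n)
    (hN : ∑ a, N a = n) (hN0 : ∀ a, 0 < N a) :
    typeWeight P N ≤ Real.exp (logCentralWeight P n) *
      Real.exp (Fintype.card κ / 2 * Real.log n - p / 4 * (‖countDeviation P n N‖ ^ 2 / n)) := by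
  have hn' : (0 : ℝ) < n := Nat.cast_pos.2 hn
  have hP (a : κ) : 0 < P a := hp.trans_le (hpP a)
  have hPle : ∀ a, P a ≤ 1 := le_one_of_sum_eq_one (fun a => (hP a).le) hP1
  have hNle (a : κ) : (N a : ℝ) ≤ n :=
    Nat.cast_le.2 (hN ▸ single_le_sum (fun _ _ => Nat.zero_le _) (mem_univ a))
  have hterm (a : κ) : p / 4 * (countDeviation P n N a ^ 2 / n) - 1 / 2 * Real.log n ≤
      logPoissonDeficit (n * P a) (N a) := by
    have hnP : n * P a ≤ n := mul_le_of_le_one_right hn'.le (hPle a)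
    have hnP0 : 0 < n * P a := mul_pos hn' (hP a)
    refine le_trans ?_ (mul_sq_div_sub_le_logPoissonDeficit hnP0 ((hpP a).trans (hPle a)) (hN0 a)
      ((mul_le_mul (hpP a) (hNle a) (Nat.cast_nonneg _) (hP a).le).trans_eq (mul_comm _ _)))
    rw [countDeviation_apply]
    gcongr
  have hsum := sum_le_sum fun a (_ : a ∈ univ) => hterm a
  rw [sum_sub_distrib, ← mul_sum, ← sum_div, ← EuclideanSpace.real_norm_sq_eq, sum_const,
    card_univ, nsmul_eq_mul] at hsum
  rw [← Real.exp_add, ← Real.log_le_iff_le_exp (typeWeight_pos hP N),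
    log_typeWeight hP hP1 hn hN]
  linarith

theorem abs_log_typeWeight_sub_le (hp : 0 < p) (hpP : ∀ a, p ≤ P a) (hP1 : ∑ a, P a = 1)
    (hn : 0 < n) (hN : ∑ a, N a = n) {B : ℝ} (hB : ∀ a, |countDeviation P n N a| ≤ B)
    (hBn : 2 * B ≤ p * n) :
    |Real.log (typeWeight P N) - (logCentralWeight P n -
        1 / 2 * ∑ a, countDeviation P n N a ^ 2 / (n * P a))| ≤
      Fintype.card κ * ((1 + B) / (p * n) + 4 * B ^ 3 / (p * n) ^ 2) := by
  have hn' : (0 : ℝ) < n := Nat.cast_pos.2 hn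
  have hnP (a : κ) : p * n ≤ n * P a := by
    rw [mul_comm]
    exact mul_le_mul_of_nonneg_left (hpP a) hn'.le
  rw [log_typeWeight (fun a => hp.trans_le (hpP a)) hP1 hn hN, sub_sub_sub_cancel_left,
    abs_sub_comm, mul_sum, ← sum_sub_distrib]
  refine (abs_sum_le_sum_abs _ _).trans ?_
  rw [← nsmul_eq_mul, ← card_univ]
  refine sum_le_card_nsmul _ _ _ fun a _ => ?_
  have hB0 : 0 ≤ B := (abs_nonneg _).trans (hB a)
  refine (abs_logPoissonDeficit_sub_le ((mul_pos hp hn').trans_le (hnP a)) (hB a)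
    (hBn.trans (hnP a))).trans ?_
  exact add_le_add (div_le_div_of_nonneg_left (by positivity) (by positivity) (hnP a))
    (div_le_div_of_nonneg_left (by positivity) (by positivity)
      (pow_le_pow_left₀ (by positivity) (hnP a) 2))

end WeightBounds

section NearestPoint

section Convex

variable {E : Type*} [NormedAddCommGroup E] [InnerProductSpace ℝ E] {y y' p p' : E}

theorem inner_sub_nonpos_of_forall_norm_sub_le {S : Set E} (hS : Convex ℝ S) (hp : p ∈ S)
    (hmin : ∀ q ∈ S, ‖y - p‖ ≤ ‖y - q‖) {q : E} (hq : q ∈ S) : inner ℝ (y - p) (q - p) ≤ 0 := by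
  refine (norm_eq_iInf_iff_real_inner_le_zero hS hp).1 ?_ q hq
  have : Nonempty S := ⟨⟨p, hp⟩⟩
  have hbdd : BddBelow (Set.range fun w : S => ‖y - w‖) :=
    ⟨0, Set.forall_mem_range.2 fun _ => norm_nonneg _⟩
  exact le_antisymm (le_ciInf fun w => hmin w w.2) (ciInf_le hbdd ⟨p, hp⟩)

theorem norm_sub_le_norm_sub_of_inner_nonpos (h : inner ℝ (y - p) (p' - p) ≤ 0)
    (h' : inner ℝ (y' - p') (p - p') ≤ 0) : ‖p - p'‖ ≤ ‖y - y'‖ := by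
  have hsplit : inner ℝ (y - y') (p - p') - inner ℝ (p - p') (p - p') =
      -(inner ℝ (y - p) (p' - p) + inner ℝ (y' - p') (p - p')) := by
    simp only [inner_sub_left, inner_sub_right]
    ring
  have hsq : ‖p - p'‖ * ‖p - p'‖ ≤ ‖y - y'‖ * ‖p - p'‖ := by
    rw [← real_inner_self_eq_norm_mul_norm]
    linarith [real_inner_le_norm (y - y') (p - p')]
  rcases (norm_nonneg (p - p')).eq_or_lt with h0 | h0
  · exact h0 ▸ norm_nonneg _
  · exact le_of_mul_le_mul_right hsq h0

end Convex

variable {k : ℕ} {S : Set (Vec k)}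

theorem nearestPoint_spec (hS : IsClosed S) (hne : S.Nonempty) (y : Vec k) :
    nearestPoint S y ∈ S ∧ ∀ q ∈ S, ‖y - nearestPoint S y‖ ≤ ‖y - q‖ := by
  apply Classical.epsilon_spec (p := fun p => p ∈ S ∧ ∀ q ∈ S, ‖y - p‖ ≤ ‖y - q‖)
  obtain ⟨p, hp, hdist⟩ := hS.exists_infDist_eq_dist hne y
  refine ⟨p, hp, fun q hq => ?_⟩
  rw [← dist_eq_norm, ← dist_eq_norm, ← hdist]
  exact Metric.infDist_le_dist_of_mem hq

theorem nearestPoint_eq_self (hS : IsClosed S) {y : Vec k} (hy : y ∈ S) :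
    nearestPoint S y = y := by
  have hle := (nearestPoint_spec hS ⟨y, hy⟩ y).2 y hy
  rw [sub_self, norm_zero, norm_le_zero_iff, sub_eq_zero] at hle
  exact hle.symm

theorem lipschitzWith_nearestPoint (hS : IsClosed S) (hc : Convex ℝ S) (hne : S.Nonempty) :
    LipschitzWith 1 (nearestPoint S) :=
  LipschitzWith.mk_one fun y y' => by
    obtain ⟨hmem, hmin⟩ := nearestPoint_spec hS hne y
    obtain ⟨hmem', hmin'⟩ := nearestPoint_spec hS hne y'
    rw [dist_eq_norm, dist_eq_norm]
    exact norm_sub_le_norm_sub_of_inner_nonpos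
      (inner_sub_nonpos_of_forall_norm_sub_le hc hmem hmin hmem')
      (inner_sub_nonpos_of_forall_norm_sub_le hc hmem' hmin' hmem)

end NearestPoint

section LocalChart

variable {k d : ℕ} (h : Fin k → Fin d → ℝ) (α : Fin d → ℝ)

theorem isClosed_closedFeasible : IsClosed (closedFeasible h α) := by
  simp only [closedFeasible, moment, Set.ofPred_and, Set.ofPred_forall]
  exact (isClosed_iInter fun x => isClosed_le continuous_const (by fun_prop)).inter
    ((isClosed_eq (by fun_prop) continuous_const).inter
      (isClosed_eq (by fun_prop) continuous_const))

theorem convex_closedFeasible : Convex ℝ (closedFeasible h α) := by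
  rintro P ⟨hP0, hP1, hPα⟩ R ⟨hR0, hR1, hRα⟩ s t hs ht hst
  refine ⟨fun x => add_nonneg (mul_nonneg hs (hP0 x)) (mul_nonneg ht (hR0 x)), ?_, ?_⟩
  · simp [sum_add_distrib, ← mul_sum, hP1, hR1, hst]
  · have hmoment : moment h (s • P + t • R) = s • moment h P + t • moment h R := by
      simp [moment, add_smul, sum_add_distrib, mul_smul, smul_sum]
    rw [hmoment, hPα, hRα, ← add_smul, hst, one_smul]

theorem feasible_subset_closedFeasible : feasible h α ⊆ closedFeasible h α :=
  fun _ hP => ⟨fun x => (hP.1.1 x).le, hP.1.2, hP.2⟩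

variable {h α} {P : Vec k}

theorem localChart_mem_closedFeasible (hP : P ∈ feasible h α) (n : ℕ) (v : tangentSpace h) :
    localChart h α P n v ∈ closedFeasible h α :=
  (nearestPoint_spec (isClosed_closedFeasible h α) ⟨P, feasible_subset_closedFeasible h α hP⟩ _).1

theorem localChart_eq_add_smul (hP : P ∈ feasible h α) (n : ℕ) (v : tangentSpace h)
    (hv : ∀ a, 0 < (P + (√n)⁻¹ • (v : Vec k)) a) :
    localChart h α P n v = P + (√n)⁻¹ • (v : Vec k) := by
  refine nearestPoint_eq_self (isClosed_closedFeasible h α) (feasible_subset_closedFeasible h α ?_)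
  refine (mem_feasible_iff hP).2 ⟨hv, ?_⟩
  rw [add_sub_cancel_left]
  exact Submodule.smul_mem _ _ v.2

theorem continuous_localChart (hP : P ∈ feasible h α) (n : ℕ) :
    Continuous (localChart h α P n) :=
  (lipschitzWith_nearestPoint (isClosed_closedFeasible h α) (convex_closedFeasible h α)
    ⟨P, feasible_subset_closedFeasible h α hP⟩).continuous.comp (by fun_prop)

theorem continuous_iidProb (m : ℕ) (A : Set (Fin m → Fin k)) :
    Continuous fun P : Vec k => iidProb P m A := by
  classical
  simp only [iidProb, Set.indicator_apply]
  refine continuous_finsetSum _ fun x _ => ?_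
  split_ifs
  · fun_prop
  · exact continuous_const

end LocalChart

section GaussianIntegral

variable {E : Type*} [NormedAddCommGroup E] [InnerProductSpace ℝ E] [FiniteDimensional ℝ E]
  {H : E →ₗ[ℝ] E}

theorem eigenvalues_pos (hH : H.IsSymmetric) (hpos : ∀ v ≠ 0, 0 < inner ℝ v (H v))
    (i : Fin (Module.finrank ℝ E)) : 0 < hH.eigenvalues rfl i := by
  have := hpos _ ((hH.eigenvectorBasis rfl).toBasis.ne_zero i)
  simpa [hH.apply_eigenvectorBasis rfl, real_inner_smul_right] using this

theorem inner_apply_eq_sum_eigenvalues_mul_sq (hH : H.IsSymmetric) (v : E) :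
    inner ℝ v (H v) = ∑ i, hH.eigenvalues rfl i * (hH.eigenvectorBasis rfl).repr v i ^ 2 := by
  rw [← (hH.eigenvectorBasis rfl).repr.inner_map_map, PiLp.inner_apply]
  refine sum_congr rfl fun i _ => ?_
  rw [hH.eigenvectorBasis_apply_self_apply rfl]
  simp only [RCLike.inner_apply, conj_trivial, RCLike.ofReal_real_eq_id, id_eq]
  ring

variable [MeasurableSpace E] [BorelSpace E]

theorem integral_exp_neg_half_inner (hH : H.IsSymmetric)
    (hpos : ∀ v ≠ 0, 0 < inner ℝ v (H v)) :
    ∫ v, Real.exp (-(1 / 2) * inner ℝ v (H v)) =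
      (√(LinearMap.det H))⁻¹ * (2 * Real.pi) ^ ((Module.finrank ℝ E : ℝ) / 2) := by
  have hpos := eigenvalues_pos hH hpos
  set b := hH.eigenvectorBasis rfl
  set lam := hH.eigenvalues rfl
  calc ∫ v, Real.exp (-(1 / 2) * inner ℝ v (H v))
      = ∫ v, ∏ i, Real.exp (-(lam i / 2) * b.repr v i ^ 2) := by
        simp only [inner_apply_eq_sum_eigenvalues_mul_sq hH, mul_sum, Real.exp_sum]
        refine integral_congr_ae (.of_forall fun v => prod_congr rfl fun i _ => ?_)
        congr 1
        ring
    _ = ∫ x : EuclideanSpace ℝ (Fin (Module.finrank ℝ E)),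
          ∏ i, Real.exp (-(lam i / 2) * x i ^ 2) :=
        b.measurePreserving_repr.integral_comp b.repr.toHomeomorph.measurableEmbedding
          fun x => ∏ i, Real.exp (-(lam i / 2) * x i ^ 2)
    _ = ∫ x : Fin (Module.finrank ℝ E) → ℝ, ∏ i, Real.exp (-(lam i / 2) * x i ^ 2) :=
        (EuclideanSpace.volume_preserving_symm_measurableEquiv_toLp _).integral_comp
          (MeasurableEquiv.measurableEmbedding _)
          fun x : Fin (Module.finrank ℝ E) → ℝ => ∏ i, Real.exp (-(lam i / 2) * x i ^ 2)
    _ = ∏ i, √(2 * Real.pi / lam i) := by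
        rw [integral_fintype_prod_volume_eq_prod fun i x => Real.exp (-(lam i / 2) * x ^ 2)]
        refine prod_congr rfl fun i _ => ?_
        rw [integral_gaussian, div_div_eq_mul_div, mul_comm]
    _ = (√(LinearMap.det H))⁻¹ * (2 * Real.pi) ^ ((Module.finrank ℝ E : ℝ) / 2) := by
        rw [hH.det_eq_prod_eigenvalues rfl]
        simp only [RCLike.ofReal_real_eq_id, id_eq]
        rw [Real.sqrt_eq_rpow, ← Real.finsetProd_rpow _ _ fun i _ => (hpos i).le]
        simp only [← Real.sqrt_eq_rpow, Real.sqrt_div Real.two_pi_pos.le, prod_div_distrib,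
          prod_const, card_univ, Fintype.card_fin]
        rw [div_eq_inv_mul, Real.sqrt_eq_rpow, ← Real.rpow_mul_natCast Real.two_pi_pos.le,
          one_div_mul_eq_div]

theorem integrable_exp_neg_mul_sq_norm {c : ℝ} (hc : 0 < c) :
    Integrable fun v : E => Real.exp (-c * ‖v‖ ^ 2) := by
  refine .of_integral_ne_zero ?_
  rw [GaussianFourier.integral_rexp_neg_mul_sq_norm hc]
  positivity

end GaussianIntegral

section GaussianKernel

variable {κ : Type*} [Fintype κ] {P : EuclideanSpace ℝ κ}

/-- The unnormalized Gaussian density with precision matrix `diag(1/P)`. -/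
def gaussianKernel (P v : EuclideanSpace ℝ κ) : ℝ :=
  Real.exp (-(1 / 2) * ∑ a, v a ^ 2 / P a)

theorem gaussianKernel_pos (P v : EuclideanSpace ℝ κ) : 0 < gaussianKernel P v :=
  Real.exp_pos _

theorem continuous_gaussianKernel (P : EuclideanSpace ℝ κ) : Continuous (gaussianKernel P) := by
  unfold gaussianKernel
  fun_prop

theorem gaussianKernel_le (hP : ∀ a, 0 < P a) (hP1 : ∀ a, P a ≤ 1) (v : EuclideanSpace ℝ κ) :
    gaussianKernel P v ≤ Real.exp (-(1 / 2) * ‖v‖ ^ 2) := by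
  rw [gaussianKernel, EuclideanSpace.real_norm_sq_eq]
  refine Real.exp_le_exp.2 (mul_le_mul_of_nonpos_left ?_ (by norm_num))
  exact sum_le_sum fun a _ => le_div_self (sq_nonneg _) (hP a) (hP1 a)

theorem le_gaussianKernel {p : ℝ} (hp : 0 < p) (hP : ∀ a, p ≤ P a) (v : EuclideanSpace ℝ κ) :
    Real.exp (-(1 / (2 * p)) * ‖v‖ ^ 2) ≤ gaussianKernel P v := by
  have hsum : ∑ a, v a ^ 2 / P a ≤ (∑ a, v a ^ 2) / p := by
    rw [sum_div]
    exact sum_le_sum fun a _ => div_le_div_of_nonneg_left (sq_nonneg _) hp (hP a)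
  rw [gaussianKernel, EuclideanSpace.real_norm_sq_eq]
  refine Real.exp_le_exp.2 ((mul_le_mul_of_nonpos_left hsum (by norm_num)).trans_eq' ?_)
  field_simp

theorem integrable_gaussianKernel (hP : ∀ a, 0 < P a) (hP1 : ∀ a, P a ≤ 1)
    (T : Submodule ℝ (EuclideanSpace ℝ κ)) : Integrable fun v : T => gaussianKernel P v := by
  refine (integrable_exp_neg_mul_sq_norm (c := 1 / 2) (by norm_num)).mono'
    ((continuous_gaussianKernel P).comp continuous_subtype_val).aestronglyMeasurable
    (.of_forall fun v => ?_)
  rw [Real.norm_of_nonneg (gaussianKernel_pos P v).le]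
  exact gaussianKernel_le hP hP1 v

theorem integral_gaussianKernel_pos (hP : ∀ a, 0 < P a) (hP1 : ∀ a, P a ≤ 1)
    (T : Submodule ℝ (EuclideanSpace ℝ κ)) : 0 < ∫ v : T, gaussianKernel P v :=
  integral_pos_of_integrable_nonneg_nonzero (x := 0)
    ((continuous_gaussianKernel P).comp continuous_subtype_val)
    (integrable_gaussianKernel hP hP1 T) (fun _ => (gaussianKernel_pos P _).le)
    (gaussianKernel_pos P _).ne'

end GaussianKernel

section GaussianDensity

variable {k d : ℕ} (h : Fin k → Fin d → ℝ)

theorem inner_tangentHessian (P : Vec k) (v w : tangentSpace h) :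
    inner ℝ v (tangentHessian h P w) = ∑ a, v.1 a * w.1 a / P a := by
  have hproj : ((tangentHessian h P w : tangentSpace h) : Vec k) =
      (tangentSpace h).starProjection (ambientHessian P ((tangentSpace h).starProjection w)) := rfl
  rw [Submodule.coe_inner, hproj, Submodule.starProjection_eq_self_iff.2 w.2,
    ← Submodule.inner_starProjection_left_eq_right, Submodule.starProjection_eq_self_iff.2 v.2,
    PiLp.inner_apply]
  refine sum_congr rfl fun a _ => ?_
  simp only [ambientHessian, Matrix.toLpLin_apply, Matrix.mulVec_diagonal, RCLike.inner_apply,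
    conj_trivial]
  ring

theorem isSymmetric_tangentHessian (P : Vec k) : (tangentHessian h P).IsSymmetric := by
  intro v w
  rw [real_inner_comm, inner_tangentHessian, inner_tangentHessian]
  simp only [mul_comm]

theorem inner_tangentHessian_self_pos {P : Vec k} (hP : ∀ a, 0 < P a) {v : tangentSpace h}
    (hv : v ≠ 0) : 0 < inner ℝ v (tangentHessian h P v) := by
  obtain ⟨a, ha⟩ : ∃ a, v.1 a ≠ 0 := by
    contrapose! hv
    ext a
    exact hv a
  rw [inner_tangentHessian]
  exact sum_pos' (fun b _ => div_nonneg (mul_self_nonneg _) (hP b).le)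
    ⟨a, mem_univ a, div_pos (mul_self_pos.2 ha) (hP a)⟩

theorem gaussianDensity_eq {P : Vec k} (hP : ∀ a, 0 < P a) (v : tangentSpace h) :
    gaussianDensity h P v =
      (∫ w : tangentSpace h, gaussianKernel P w)⁻¹ * gaussianKernel P v := by
  have hkernel (w : tangentSpace h) :
      gaussianKernel P w = Real.exp (-(1 / 2) * inner ℝ w (tangentHessian h P w)) := by
    simp only [gaussianKernel, inner_tangentHessian, sq]
  simp only [hkernel]
  rw [integral_exp_neg_half_inner (isSymmetric_tangentHessian h P)
    fun v => inner_tangentHessian_self_pos h hP, gaussianDensity, mul_inv, inv_inv, neg_div,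
    Real.rpow_neg Real.two_pi_pos.le]

theorem tangentLebesgue_eq_volume : tangentLebesgue h = volume :=
  (stdOrthonormalBasis ℝ (tangentSpace h)).addHaar_eq_volume

end GaussianDensity

section IntegerVectors

variable {κ : Type*} [Finite κ]

theorem exists_basis_mem_span_int_iff {T : Submodule ℝ (EuclideanSpace ℝ κ)}
    (hT : Submodule.span ℝ {v | v ∈ T ∧ ∀ a, ∃ z : ℤ, v a = z} = T) :
    ∃ (r : ℕ) (b : Module.Basis (Fin r) ℝ T), ∀ v : T,
      v ∈ Submodule.span ℤ (Set.range b) ↔ ∀ a, ∃ z : ℤ, v.1 a = z := by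
  have := Fintype.ofFinite κ
  let e := (EuclideanSpace.basisFun κ ℝ).toBasis
  let L : Submodule ℤ T := ZLattice.comap ℝ (Submodule.span ℤ (Set.range e)) T.subtype
  have hmem (v : T) : v ∈ L ↔ ∀ a, ∃ z : ℤ, v.1 a = z := by
    change v.1 ∈ Submodule.span ℤ (Set.range e) ↔ _
    rw [Module.Basis.mem_span_iff_repr_mem]
    refine forall_congr' fun a => ?_
    simp [e, eq_comm]
  have hdisc : DiscreteTopology L :=
    ZLattice.comap_discreteTopology ℝ _ continuous_subtype_val T.injective_subtype
  have hspan : IsZLattice ℝ L := by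
    refine ⟨Submodule.map_injective_of_injective T.injective_subtype ?_⟩
    rw [Submodule.map_span, Submodule.map_subtype_top]
    convert hT using 2
    ext v
    constructor
    · rintro ⟨w, hw, rfl⟩
      exact ⟨w.2, (hmem w).1 hw⟩
    · rintro ⟨hvT, hv⟩
      exact ⟨⟨v, hvT⟩, (hmem _).2 hv, rfl⟩
  have hfree : Module.Free ℤ L := ZLattice.module_free ℝ L
  have hfin : Module.Finite ℤ L := ZLattice.module_finite ℝ L
  refine ⟨_, (Module.finBasis ℤ L).ofZLatticeBasis ℝ L, fun v => ?_⟩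
  rw [Module.Basis.ofZLatticeBasis_span, hmem]

end IntegerVectors

section CellApproximation

variable {E ι : Type*} [DecidableEq ι] [MeasurableSpace E]

/-- The family of weights `w` on `s` discretizes the function `G` up to the relative error `ε`:
the points of `t ⊆ s` own disjoint cells `D` of volume `V` on which `G` is close to the weight,
and both the weight of the other points and the mass of `G` outside the cells are small. It makes
weighted averages over `s` comparable with averages with respect to the density `G`. -/
structure IsCellApproximation (μ : Measure E) (s t : Finset ι) (w : ι → ℝ) (D : ι → Set E)
    (G : E → ℝ) (V ε : ℝ) : Prop where
  subset : t ⊆ s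
  weight_nonneg : ∀ i ∈ s, 0 ≤ w i
  integrable : Integrable G μ
  density_nonneg : ∀ v, 0 ≤ G v
  measurableSet : ∀ i ∈ t, MeasurableSet (D i)
  pairwiseDisjoint : (t : Set ι).PairwiseDisjoint D
  volume_pos : 0 < V
  measureReal_eq : ∀ i ∈ t, μ.real (D i) = V
  abs_weight_sub_le : ∀ i ∈ t, ∀ v ∈ D i, |w i - G v| ≤ ε * G v
  sum_sdiff_le : V * ∑ i ∈ s \ t, w i ≤ ε * ∫ v, G v ∂μ
  setIntegral_compl_le : ∫ v in (⋃ i ∈ t, D i)ᶜ, G v ∂μ ≤ ε * ∫ v, G v ∂μ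

namespace IsCellApproximation

variable {μ : Measure E} {s t : Finset ι} {w γ : ι → ℝ} {D : ι → Set E} {G π : E → ℝ} {V ε : ℝ}

theorem integral_eq_sum_add (hA : IsCellApproximation μ s t w D G V ε) {f : E → ℝ}
    (hf : Integrable f μ) :
    ∫ v, f v ∂μ = ∑ i ∈ t, ∫ v in D i, f v ∂μ + ∫ v in (⋃ i ∈ t, D i)ᶜ, f v ∂μ := by
  rw [← integral_biUnion_finset t hA.measurableSet hA.pairwiseDisjoint fun i _ => hf.integrableOn,
    integral_add_compl (t.measurableSet_biUnion hA.measurableSet) hf]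

theorem integrable_mul (hA : IsCellApproximation μ s t w D G V ε) (hπ : AEStronglyMeasurable π μ)
    (hπ01 : ∀ v, π v ∈ Set.Icc 0 1) : Integrable (fun v => π v * G v) μ := by
  refine hA.integrable.mono' (hπ.mul hA.integrable.aestronglyMeasurable) (.of_forall fun v => ?_)
  rw [Real.norm_of_nonneg (mul_nonneg (hπ01 v).1 (hA.density_nonneg v))]
  exact mul_le_of_le_one_left (hA.density_nonneg v) (hπ01 v).2

theorem abs_mul_sub_setIntegral_le (hA : IsCellApproximation μ s t w D G V ε)
    (hπ : AEStronglyMeasurable π μ) (hπ01 : ∀ v, π v ∈ Set.Icc 0 1) {i : ι} (hi : i ∈ t)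
    (hγ : γ i ∈ Set.Icc 0 1) (hγπ : ∀ v ∈ D i, |γ i - π v| ≤ ε) :
    |V * (w i * γ i) - ∫ v in D i, π v * G v ∂μ| ≤ 2 * ε * ∫ v in D i, G v ∂μ := by
  have hfin : μ (D i) ≠ ⊤ := by
    intro htop
    have hV := hA.measureReal_eq i hi
    rw [measureReal_def, htop, ENNReal.toReal_top] at hV
    exact hA.volume_pos.ne hV
  have hconst : V * (w i * γ i) = ∫ _ in D i, w i * γ i ∂μ := by
    rw [setIntegral_const, hA.measureReal_eq i hi, smul_eq_mul]
  rw [hconst, ← integral_sub (integrableOn_const (C := w i * γ i) hfin)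
    (hA.integrable_mul hπ hπ01).integrableOn,
    ← integral_const_mul, ← Real.norm_eq_abs]
  refine norm_integral_le_of_norm_le (hA.integrable.integrableOn.const_mul _) ?_
  refine (ae_restrict_iff' (hA.measurableSet i hi)).2 (.of_forall fun v hv => ?_)
  have hG0 := hA.density_nonneg v
  calc |w i * γ i - π v * G v|
      = |(w i - G v) * γ i + G v * (γ i - π v)| := by ring_nf
    _ ≤ |w i - G v| * γ i + G v * |γ i - π v| := by
        refine (abs_add_le _ _).trans_eq ?_
        rw [abs_mul, abs_mul, abs_of_nonneg hG0, abs_of_nonneg hγ.1]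
    _ ≤ ε * G v + G v * ε := by
        refine add_le_add ?_ (mul_le_mul_of_nonneg_left (hγπ v hv) hG0)
        exact (mul_le_of_le_one_right (abs_nonneg _) hγ.2).trans (hA.abs_weight_sub_le i hi v hv)
    _ = 2 * ε * G v := by ring

theorem abs_mul_sum_sub_integral_le (hA : IsCellApproximation μ s t w D G V ε) (hε : 0 ≤ ε)
    (hγ : ∀ i, γ i ∈ Set.Icc 0 1) (hπ : AEStronglyMeasurable π μ)
    (hπ01 : ∀ v, π v ∈ Set.Icc 0 1) (hγπ : ∀ i ∈ t, ∀ v ∈ D i, |γ i - π v| ≤ ε) :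
    |V * ∑ i ∈ s, w i * γ i - ∫ v, π v * G v ∂μ| ≤ 4 * ε * ∫ v, G v ∂μ := by
  have hπG := hA.integrable_mul hπ hπ01
  have hcells : |∑ i ∈ t, (V * (w i * γ i) - ∫ v in D i, π v * G v ∂μ)| ≤
      2 * ε * ∫ v, G v ∂μ := by
    refine (abs_sum_le_sum_abs _ _).trans ((sum_le_sum fun i hi =>
      hA.abs_mul_sub_setIntegral_le hπ hπ01 hi (hγ i) (hγπ i hi)).trans ?_)
    rw [← mul_sum, hA.integral_eq_sum_add hA.integrable]
    exact mul_le_mul_of_nonneg_left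
      (le_add_of_nonneg_right (integral_nonneg hA.density_nonneg)) (by positivity)
  have hw (i : ι) (hi : i ∈ s \ t) : 0 ≤ w i := hA.weight_nonneg i (mem_sdiff.1 hi).1
  have hrest0 : 0 ≤ V * ∑ i ∈ s \ t, w i * γ i :=
    mul_nonneg hA.volume_pos.le (sum_nonneg fun i hi => mul_nonneg (hw i hi) (hγ i).1)
  have hrest : V * ∑ i ∈ s \ t, w i * γ i ≤ ε * ∫ v, G v ∂μ :=
    (mul_le_mul_of_nonneg_left (sum_le_sum fun i hi => mul_le_of_le_one_right (hw i hi) (hγ i).2)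
      hA.volume_pos.le).trans hA.sum_sdiff_le
  have hout0 : 0 ≤ ∫ v in (⋃ i ∈ t, D i)ᶜ, π v * G v ∂μ :=
    integral_nonneg fun v => mul_nonneg (hπ01 v).1 (hA.density_nonneg v)
  have hout : ∫ v in (⋃ i ∈ t, D i)ᶜ, π v * G v ∂μ ≤ ε * ∫ v, G v ∂μ :=
    (integral_mono hπG.integrableOn hA.integrable.integrableOn
      fun v => mul_le_of_le_one_left (hA.density_nonneg v) (hπ01 v).2).trans
      hA.setIntegral_compl_le
  have hsplit : V * ∑ i ∈ s, w i * γ i - ∫ v, π v * G v ∂μ =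
      ∑ i ∈ t, (V * (w i * γ i) - ∫ v in D i, π v * G v ∂μ) +
        V * ∑ i ∈ s \ t, w i * γ i - ∫ v in (⋃ i ∈ t, D i)ᶜ, π v * G v ∂μ := by
    rw [← sum_sdiff hA.subset, hA.integral_eq_sum_add hπG, sum_sub_distrib, ← mul_sum]
    ring
  rw [hsplit, abs_le]
  rw [abs_le] at hcells
  constructor <;> linarith

end IsCellApproximation

theorem abs_div_sub_div_le {W Z I J δ : ℝ} (hW : 0 ≤ W) (hWZ : W ≤ Z) (hZ : 0 < Z) (hI : 0 < I)
    (hWJ : |W - J| ≤ δ * I) (hZI : |Z - I| ≤ δ * I) : |W / Z - J / I| ≤ 2 * δ := by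
  have hsplit : W / Z - J / I = (W - J + W / Z * -(Z - I)) / I := by
    field_simp
    ring
  rw [hsplit, abs_div, abs_of_pos hI, div_le_iff₀ hI]
  refine (abs_add_le _ _).trans ?_
  rw [abs_mul, abs_neg, abs_of_nonneg (div_nonneg hW hZ.le)]
  have hquot := mul_le_mul ((div_le_one hZ).2 hWZ) hZI (abs_nonneg _) zero_le_one
  linarith

theorem IsCellApproximation.abs_average_sub_average_le {μ : Measure E} {s t : Finset ι}
    {w γ : ι → ℝ} {D : ι → Set E} {G π : E → ℝ} {V ε : ℝ}
    (hA : IsCellApproximation μ s t w D G V ε) (hε : 0 ≤ ε) (hw : 0 < ∑ i ∈ s, w i)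
    (hG : 0 < ∫ v, G v ∂μ) (hγ : ∀ i, γ i ∈ Set.Icc 0 1) (hπ : AEStronglyMeasurable π μ)
    (hπ01 : ∀ v, π v ∈ Set.Icc 0 1) (hγπ : ∀ i ∈ t, ∀ v ∈ D i, |γ i - π v| ≤ ε) :
    |(∑ i ∈ s, w i * γ i) / ∑ i ∈ s, w i - (∫ v, π v * G v ∂μ) / ∫ v, G v ∂μ| ≤ 8 * ε := by
  have hZ := hA.abs_mul_sum_sub_integral_le (γ := 1) (π := 1) hε (by simp)
    aestronglyMeasurable_const (by simp) (by simpa using fun _ _ _ _ => hε)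
  simp only [Pi.one_apply, mul_one, one_mul] at hZ
  rw [← mul_div_mul_left _ _ hA.volume_pos.ne']
  refine (abs_div_sub_div_le ?_ ?_ (mul_pos hA.volume_pos hw) hG
    (hA.abs_mul_sum_sub_integral_le hε hγ hπ hπ01 hγπ) hZ).trans_eq (by ring)
  · exact mul_nonneg hA.volume_pos.le
      (sum_nonneg fun i hi => mul_nonneg (hA.weight_nonneg i hi) (hγ i).1)
  · exact mul_le_mul_of_nonneg_left
      (sum_le_sum fun i hi => mul_le_of_le_one_right (hA.weight_nonneg i hi) (hγ i).2)
      hA.volume_pos.le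

end CellApproximation

section LocalLimit

variable {κ : Type*} [Fintype κ] {P v w : EuclideanSpace ℝ κ} {p : ℝ}

theorem abs_log_gaussianKernel_sub_le (hp : 0 < p) (hpP : ∀ a, p ≤ P a) :
    |Real.log (gaussianKernel P v) - Real.log (gaussianKernel P w)| ≤
      ‖v - w‖ * ‖v + w‖ / (2 * p) := by
  have hP (a : κ) : 0 < P a := hp.trans_le (hpP a)
  have hsum : |∑ a, (v a ^ 2 - w a ^ 2) / P a| ≤ ‖v - w‖ * ‖v + w‖ / p := by
    calc |∑ a, (v a ^ 2 - w a ^ 2) / P a|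
        ≤ ∑ a, |(v - w) a| * |(v + w) a| / p := by
          refine (abs_sum_le_sum_abs _ _).trans (sum_le_sum fun a _ => ?_)
          rw [← abs_mul, abs_div, abs_of_pos (hP a), PiLp.sub_apply, PiLp.add_apply, mul_comm,
            ← sq_sub_sq]
          exact div_le_div_of_nonneg_left (abs_nonneg _) hp (hpP a)
      _ ≤ ‖v - w‖ * ‖v + w‖ / p := by
          rw [← sum_div, EuclideanSpace.norm_eq, EuclideanSpace.norm_eq]
          exact div_le_div_of_nonneg_right (Real.sum_mul_le_sqrt_mul_sqrt _ _ _) hp.le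
  calc |Real.log (gaussianKernel P v) - Real.log (gaussianKernel P w)|
      = 1 / 2 * |∑ a, (v a ^ 2 - w a ^ 2) / P a| := by
        simp only [gaussianKernel, Real.log_exp, sub_div, sum_sub_distrib]
        rw [← mul_sub, abs_mul, abs_neg, abs_of_pos one_half_pos]
    _ ≤ 1 / 2 * (‖v - w‖ * ‖v + w‖ / p) := by gcongr
    _ = ‖v - w‖ * ‖v + w‖ / (2 * p) := by field_simp

theorem abs_sub_le_of_abs_log_sub_log_le {x y δ : ℝ} (hx : 0 < x) (hy : 0 < y)
    (hδ : |Real.log x - Real.log y| ≤ δ) (hδ1 : δ ≤ 1) : |x - y| ≤ 2 * δ * y := by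
  have hexp : x - y = (Real.exp (Real.log x - Real.log y) - 1) * y := by
    rw [Real.exp_sub, Real.exp_log hx, Real.exp_log hy, sub_one_mul, div_mul_cancel₀ _ hy.ne']
  rw [hexp, abs_mul, abs_of_pos hy]
  gcongr
  exact (Real.abs_exp_sub_one_le (hδ.trans hδ1)).trans (by gcongr)

variable {n : ℕ} {N : κ → ℕ} {R ρ : ℝ}

theorem abs_log_typeWeight_sub_log_gaussianKernel_le (hp : 0 < p) (hpP : ∀ a, p ≤ P a)
    (hP1 : ∑ a, P a = 1) (hn : 0 < n) (hN : ∑ a, N a = n) (hR : 1 ≤ R)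
    (hNR : ‖countDeviation P n N‖ ≤ √n * R) (hRn : 2 * (√n * R) ≤ p * n) :
    |Real.log (typeWeight P N) - (logCentralWeight P n +
        Real.log (gaussianKernel P ((√n)⁻¹ • countDeviation P n N)))| ≤
      Fintype.card κ * (2 / p + 4 / p ^ 2) * (R ^ 3 / √n) := by
  have hs : 0 < √(n : ℝ) := Real.sqrt_pos.2 (Nat.cast_pos.2 hn)
  have hs1 : 1 ≤ √(n : ℝ) := Real.one_le_sqrt.2 (Nat.one_le_cast.2 hn)
  have hns : √(n : ℝ) ^ 2 = n := Real.sq_sqrt n.cast_nonneg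
  have hkernel : Real.log (gaussianKernel P ((√n)⁻¹ • countDeviation P n N)) =
      -(1 / 2 * ∑ a, countDeviation P n N a ^ 2 / (n * P a)) := by
    rw [gaussianKernel, Real.log_exp, neg_mul]
    simp only [PiLp.smul_apply, smul_eq_mul, ← div_eq_inv_mul, div_pow, hns, div_div]
  rw [hkernel, ← sub_eq_add_neg]
  refine (abs_log_typeWeight_sub_le hp hpP hP1 hn hN
    (fun a => (PiLp.norm_apply_le _ a).trans hNR) hRn).trans ?_
  rw [mul_assoc]
  refine mul_le_mul_of_nonneg_left ?_ (Nat.cast_nonneg _)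
  have hfirst : (1 + √n * R) / (p * n) ≤ 2 / p * (R ^ 3 / √n) := by
    have hsR : 1 + √n * R ≤ 2 * (√n * R ^ 3) := by
      have h1 : 1 ≤ √n * R ^ 3 := one_le_mul_of_one_le_of_one_le hs1 (one_le_pow₀ hR)
      have h2 : √n * R ≤ √n * R ^ 3 :=
        mul_le_mul_of_nonneg_left (le_self_pow₀ hR (by norm_num)) hs.le
      linarith
    calc (1 + √n * R) / (p * n) ≤ 2 * (√n * R ^ 3) / (p * √n ^ 2) := by rw [hns]; gcongr
      _ = 2 / p * (R ^ 3 / √n) := by field_simp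
  have hsecond : 4 * (√n * R) ^ 3 / (p * n) ^ 2 = 4 / p ^ 2 * (R ^ 3 / √n) := by
    conv_lhs => rw [← hns, Real.sqrt_sq hs.le]
    field_simp
  linarith

theorem norm_sub_inv_sqrt_smul_le {u : EuclideanSpace ℝ κ} (hn : 0 < n)
    (hvu : ‖√n • v - u‖ ≤ ρ) : ‖v - (√n)⁻¹ • u‖ ≤ ρ / √n := by
  have hs : 0 < √(n : ℝ) := Real.sqrt_pos.2 (Nat.cast_pos.2 hn)
  have hscale : √n • v - u = √n • (v - (√n)⁻¹ • u) := by
    rw [smul_sub, smul_inv_smul₀ hs.ne']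
  rw [hscale, norm_smul, Real.norm_of_nonneg hs.le] at hvu
  rwa [le_div_iff₀' hs]

theorem abs_log_gaussianKernel_sub_log_gaussianKernel_inv_sqrt_smul_le
    {u : EuclideanSpace ℝ κ} (hp : 0 < p) (hpP : ∀ a, p ≤ P a) (hn : 0 < n) (hR : 1 ≤ R)
    (hu : ‖u‖ ≤ √n * R) (hvu : ‖√n • v - u‖ ≤ ρ) (hρ : ρ ≤ √n) :
    |Real.log (gaussianKernel P ((√n)⁻¹ • u)) - Real.log (gaussianKernel P v)| ≤
      2 * ρ / p * (R ^ 3 / √n) := by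
  have hs : 0 < √(n : ℝ) := Real.sqrt_pos.2 (Nat.cast_pos.2 hn)
  have hρ0 : 0 ≤ ρ := (norm_nonneg _).trans hvu
  have hdiff := norm_sub_inv_sqrt_smul_le hn hvu
  set y := (√n)⁻¹ • u
  have hy : ‖y‖ ≤ R := by
    rwa [norm_smul, norm_inv, Real.norm_of_nonneg hs.le, inv_mul_le_iff₀ hs]
  have hsum : ‖v + y‖ ≤ 3 * R := by
    have hle1 : ρ / √n ≤ 1 := (div_le_one hs).2 hρ
    calc ‖v + y‖ = ‖(v - y) + (y + y)‖ := by congr 1; abel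
      _ ≤ ‖v - y‖ + (‖y‖ + ‖y‖) := (norm_add_le _ _).trans (by gcongr; exact norm_add_le _ _)
      _ ≤ 3 * R := by linarith
  rw [abs_sub_comm]
  calc |Real.log (gaussianKernel P v) - Real.log (gaussianKernel P y)|
      ≤ ‖v - y‖ * ‖v + y‖ / (2 * p) := abs_log_gaussianKernel_sub_le hp hpP
    _ ≤ ρ / √n * (3 * R) / (2 * p) := by gcongr
    _ = 3 / 2 * ρ / p * (R / √n) := by field_simp
    _ ≤ 2 * ρ / p * (R ^ 3 / √n) := by
        gcongr
        · norm_num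
        · exact le_self_pow₀ hR (by norm_num)

/-- The constant of the local limit theorem for a cell of diameter `ρ`, over an alphabet of `c`
letters each of weight at least `p`. -/
def localLimitConst (c : ℕ) (p ρ : ℝ) : ℝ :=
  c * (2 / p + 4 / p ^ 2) + 2 * ρ / p

theorem abs_typeWeight_sub_le (hp : 0 < p) (hpP : ∀ a, p ≤ P a) (hP1 : ∑ a, P a = 1)
    (hn : 0 < n) (hN : ∑ a, N a = n) (hR : 1 ≤ R) (hNR : ‖countDeviation P n N‖ ≤ √n * R)
    (hRn : 2 * (√n * R) ≤ p * n) (hvN : ‖√n • v - countDeviation P n N‖ ≤ ρ) (hρ : ρ ≤ √n)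
    (hsmall : localLimitConst (Fintype.card κ) p ρ * (R ^ 3 / √n) ≤ 1) :
    |typeWeight P N - Real.exp (logCentralWeight P n) * gaussianKernel P v| ≤
      2 * (localLimitConst (Fintype.card κ) p ρ * (R ^ 3 / √n)) *
        (Real.exp (logCentralWeight P n) * gaussianKernel P v) := by
  have hkernel := gaussianKernel_pos P v
  refine abs_sub_le_of_abs_log_sub_log_le (typeWeight_pos (fun a => hp.trans_le (hpP a)) N)
    (by positivity) ?_ hsmall
  rw [Real.log_mul (Real.exp_ne_zero _) hkernel.ne', Real.log_exp, localLimitConst, add_mul]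
  refine (abs_sub_le _ (logCentralWeight P n +
    Real.log (gaussianKernel P ((√n)⁻¹ • countDeviation P n N))) _).trans (add_le_add ?_ ?_)
  · exact abs_log_typeWeight_sub_log_gaussianKernel_le hp hpP hP1 hn hN hR hNR hRn
  · rw [add_sub_add_left_eq_sub]
    exact abs_log_gaussianKernel_sub_log_gaussianKernel_inv_sqrt_smul_le hp hpP hn hR hNR hvN hρ

end LocalLimit

section SamplingFromType

variable {κ : Type*} {P v : EuclideanSpace ℝ κ} {p R ρ : ℝ} {n m : ℕ} {N : κ → ℕ}

theorem abs_div_sub_add_smul_apply_le (hn : 0 < n) {a : κ}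
    (hvN : |√n * v a - countDeviation P n N a| ≤ ρ) :
    |N a / n - (P + (√n)⁻¹ • v) a| ≤ ρ / n := by
  have hn' : (0 : ℝ) < n := Nat.cast_pos.2 hn
  have hns : √(n : ℝ) * √n = n := Real.mul_self_sqrt n.cast_nonneg
  have hscale : N a / n - (P + (√n)⁻¹ • v) a = -(√n * v a - countDeviation P n N a) / n := by
    rw [countDeviation_apply, PiLp.add_apply, PiLp.smul_apply, smul_eq_mul]
    field_simp
    linear_combination v a * hns
  rw [hscale, abs_div, abs_neg, abs_of_pos hn']
  gcongr

theorem half_mul_le_of_norm_countDeviation_le [Fintype κ] (hpP : ∀ a, p ≤ P a)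
    (hNR : ‖countDeviation P n N‖ ≤ √n * R) (hRn : 2 * (√n * R) ≤ p * n) (a : κ) :
    p / 2 * n ≤ N a := by
  have hdev := (abs_le.1 ((PiLp.norm_apply_le (countDeviation P n N) a).trans hNR)).1
  rw [countDeviation_apply] at hdev
  have hpPn : n * p ≤ n * P a := mul_le_mul_of_nonneg_left (hpP a) n.cast_nonneg
  linarith

end SamplingFromType

/-- The constant in the comparison of draws without replacement with independent draws from a law
at distance `ρ / n`, over an alphabet of `c` letters each of weight at least `p`. -/
def samplingConst (c : ℕ) (p ρ : ℝ) : ℝ :=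
  c / 2 + 8 / p ^ 2 + c * ρ

theorem abs_withoutReplacementProb_sub_iidProb_le {k n m : ℕ} (hmn : m ≤ n) {P v : Vec k}
    {N : Fin k → ℕ} {p R ρ : ℝ} (hp : 0 < p) (hpP : ∀ a, p ≤ P a) (hP1 : ∑ a, P a = 1)
    (hn : 0 < n) (hN : ∑ a, N a = n) (hNR : ‖countDeviation P n N‖ ≤ √n * R)
    (hRn : 2 * (√n * R) ≤ p * n) (hv : ∑ a, v a = 0) (hPv : ∀ a, 0 ≤ (P + (√n)⁻¹ • v) a)
    (hvN : ‖√n • v - countDeviation P n N‖ ≤ ρ) (hm : m ^ 2 ≤ n) (hmp : 4 * m ≤ p * n)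
    (A : Set (Fin m → Fin k)) :
    |withoutReplacementProb hmn N A - iidProb (P + (√n)⁻¹ • v) m A| ≤
      samplingConst k p ρ * (m / n) := by
  have hn' : (n : ℝ) ≠ 0 := (Nat.cast_pos.2 hn).ne'
  have hNn : ∑ a, (N a : ℝ) / n = 1 := by
    rw [← sum_div, ← Nat.cast_sum, hN, div_self hn']
  let M : Vec k := WithLp.toLp 2 fun a => N a / n
  have hreplace : |withoutReplacementProb hmn N A - iidProb M m A| ≤
      (Fintype.card (Fin k) / 2 + 2 / (p / 2) ^ 2) * (m / n) :=
    abs_withoutReplacementProb_sub_le hmn hN hn (half_pos hp)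
      (half_mul_le_of_norm_countDeviation_le hpP hNR hRn) hm (by linarith) A
  have hmove : |iidProb M m A - iidProb (P + (√n)⁻¹ • v) m A| ≤
      m * ∑ a, |N a / n - (P + (√n)⁻¹ • v) a| :=
    abs_iidProb_sub_le hNn (fun a => by positivity)
      (by simp [sum_add_distrib, ← mul_sum, hP1, hv]) hPv m A
  have hdist : ∑ a, |(N a : ℝ) / n - (P + (√n)⁻¹ • v) a| ≤ k * (ρ / n) := by
    refine (sum_le_sum (g := fun _ => ρ / n) fun a _ => ?_).trans_eq (by simp)
    exact abs_div_sub_add_smul_apply_le hn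
      ((PiLp.norm_apply_le (√n • v - countDeviation P n N) a).trans hvN)
  calc |withoutReplacementProb hmn N A - iidProb (P + (√n)⁻¹ • v) m A|
      ≤ (Fintype.card (Fin k) / 2 + 2 / (p / 2) ^ 2) * (m / n) + m * (k * (ρ / n)) :=
        (abs_sub_le _ (iidProb M m A) _).trans
          (add_le_add hreplace (hmove.trans (mul_le_mul_of_nonneg_left hdist m.cast_nonneg)))
    _ = samplingConst k p ρ * (m / n) := by
        rw [Fintype.card_fin, samplingConst]
        field_simp
        ring

section TypeCells

variable {κ ι : Type*} [Fintype κ] {T : Submodule ℝ (EuclideanSpace ℝ κ)}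
  {P : EuclideanSpace ℝ κ} {n : ℕ} {N : κ → ℕ}

/-- The deviation of the counts `N` from `n P`, as an element of `T`; it is projected onto `T` only
to be defined for all counts. -/
def typeOffset (T : Submodule ℝ (EuclideanSpace ℝ κ)) (P : EuclideanSpace ℝ κ) (n : ℕ)
    (N : κ → ℕ) : T :=
  T.orthogonalProjectionOnto (countDeviation P n N)

/-- The cell of the counts `N`: the fundamental domain of the lattice spanned by `b`, moved to the
deviation of `N` and scaled by `1 / √n`. -/
def typeCell (b : Module.Basis ι ℝ T) (P : EuclideanSpace ℝ κ) (n : ℕ) (N : κ → ℕ) : Set T :=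
  {v | √n • v - typeOffset T P n N ∈ ZSpan.fundamentalDomain b}

theorem measurableSet_typeCell [Finite ι] (b : Module.Basis ι ℝ T) (P : EuclideanSpace ℝ κ) (n : ℕ)
    (N : κ → ℕ) : MeasurableSet (typeCell b P n N) :=
  (ZSpan.fundamentalDomain_measurableSet b).preimage
    (f := fun v : T => √n • v - typeOffset T P n N) (by fun_prop)

theorem volume_real_typeCell (b : Module.Basis ι ℝ T) (P : EuclideanSpace ℝ κ) (hn : 0 < n)
    (N : κ → ℕ) :
    volume.real (typeCell b P n N) =
      (√n ^ Module.finrank ℝ T)⁻¹ * volume.real (ZSpan.fundamentalDomain b) := by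
  have hs : √(n : ℝ) ≠ 0 := (Real.sqrt_pos.2 (Nat.cast_pos.2 hn)).ne'
  have hpreimage : typeCell b P n N =
      (√(n : ℝ) • ·) ⁻¹' ((· + -typeOffset T P n N) ⁻¹' ZSpan.fundamentalDomain b) := by
    simp only [typeCell, sub_eq_add_neg, Set.preimage, Set.mem_ofPred_eq]
  rw [measureReal_def, hpreimage, Measure.addHaar_preimage_smul _ hs, measure_preimage_add_right,
    ENNReal.toReal_mul, ENNReal.toReal_ofReal (abs_nonneg _), abs_of_nonneg (by positivity),
    measureReal_def]

variable [DecidableEq κ]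

theorem coe_typeOffset (hN : N ∈ types T P n) :
    (typeOffset T P n N : EuclideanSpace ℝ κ) = countDeviation P n N :=
  Submodule.starProjection_eq_self_iff.2 (mem_types.1 hN).2.2

theorem pairwiseDisjoint_typeCell [Finite ι] {b : Module.Basis ι ℝ T}
    (hb : ∀ v : T, v ∈ Submodule.span ℤ (Set.range b) ↔ ∀ a, ∃ z : ℤ, v.1 a = z)
    (P : EuclideanSpace ℝ κ) (n : ℕ) :
    (types T P n : Set (κ → ℕ)).PairwiseDisjoint (typeCell b P n) := by
  have := Fintype.ofFinite ι
  intro N hN N' hN' hne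
  refine Set.disjoint_left.2 fun v hv hv' => hne ?_
  have hfract : ZSpan.fract b (√n • v - typeOffset T P n N) =
      ZSpan.fract b (√n • v - typeOffset T P n N') := by
    refine (ZSpan.fract_eq_fract b _ _).2 ((hb _).2 fun a => ⟨N a - N' a, ?_⟩)
    simp [coe_typeOffset hN, coe_typeOffset hN', countDeviation_apply]
  rw [ZSpan.fract_eq_self.2 hv, ZSpan.fract_eq_self.2 hv', sub_right_inj, Subtype.ext_iff,
    coe_typeOffset hN, coe_typeOffset hN'] at hfract
  funext a
  simpa [countDeviation_apply] using congrArg (fun u : EuclideanSpace ℝ κ => u a) hfract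

theorem norm_le_of_mem_typeCell [Fintype ι] {b : Module.Basis ι ℝ T} (hN : N ∈ types T P n) {v : T}
    (hv : v ∈ typeCell b P n N) :
    ‖√n • (v : EuclideanSpace ℝ κ) - countDeviation P n N‖ ≤ ∑ i, ‖b i‖ := by
  rw [← coe_typeOffset hN, ← Submodule.coe_smul, ← Submodule.coe_sub, Submodule.norm_coe,
    ← ZSpan.fract_eq_self.2 hv]
  exact ZSpan.norm_fract_le b _

theorem exists_mem_types_countDeviation_eq (hT : ∀ v ∈ T, ∑ a, v a = 0) (hP1 : ∑ a, P a = 1)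
    {w : EuclideanSpace ℝ κ} (hw : w ∈ T) (hwN : ∀ a, ∃ z : ℤ, w a - countDeviation P n N a = z)
    (hwP : ∀ a, |w a| < n * P a) : ∃ M ∈ types T P n, countDeviation P n M = w := by
  choose z hz using hwN
  simp only [countDeviation_apply] at hz
  have hcount (a : κ) : w a + n * P a = (N a + z a : ℤ) := by
    push_cast
    linarith [hz a]
  have hpos (a : κ) : 0 < N a + z a := by
    have hreal : (0 : ℝ) < (N a + z a : ℤ) := by
      rw [← hcount]
      linarith [(abs_lt.1 (hwP a)).1]
    exact_mod_cast hreal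
  let M (a : κ) : ℕ := (N a + z a).toNat
  have hM (a : κ) : (M a : ℝ) = w a + n * P a := by
    rw [hcount, ← Int.toNat_of_nonneg (hpos a).le, Int.cast_natCast]
  have hdev : countDeviation P n M = w := by
    ext a
    rw [countDeviation_apply, hM, add_sub_cancel_right]
  refine ⟨M, mem_types.2 ⟨?_, fun a => ?_, hdev ▸ hw⟩, hdev⟩
  · have hsum : ∑ a, (M a : ℝ) = n := by
      simp only [hM, sum_add_distrib, hT w hw, ← mul_sum, hP1, mul_one, zero_add]
    exact_mod_cast hsum
  · exact Int.lt_toNat.2 (hpos a)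

theorem exists_mem_typeCell [Fintype ι] (hT : ∀ v ∈ T, ∑ a, v a = 0) {b : Module.Basis ι ℝ T}
    (hb : ∀ v : T, v ∈ Submodule.span ℤ (Set.range b) ↔ ∀ a, ∃ z : ℤ, v.1 a = z) {p R : ℝ}
    (hp : 0 < p) (hpP : ∀ a, p ≤ P a) (hP1 : ∑ a, P a = 1) (hn : 0 < n)
    (hne : (types T P n).Nonempty) (hbn : ∑ i, ‖b i‖ ≤ √n) (hRn : 2 * (√n * R) ≤ p * n)
    {v : T} (hv : ‖v‖ ≤ R - 1) :
    ∃ N ∈ types T P n, ‖countDeviation P n N‖ ≤ √n * R ∧ v ∈ typeCell b P n N := by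
  have hpn : 0 < p * n := by positivity
  obtain ⟨N₀, hN₀⟩ := hne
  obtain ⟨z, hz, -⟩ :=
    ZSpan.exist_unique_vadd_mem_fundamentalDomain b (√n • v - typeOffset T P n N₀)
  let w : T := typeOffset T P n N₀ - z
  have hvw : √n • v - w ∈ ZSpan.fundamentalDomain b := by
    convert hz using 1
    rw [Submodule.vadd_def, vadd_eq_add]
    simp only [w]
    abel
  have hwR : ‖w‖ ≤ √n * R := by
    have hround : ‖√n • v - w‖ ≤ √n := by
      rw [← ZSpan.fract_eq_self.2 hvw]
      exact (ZSpan.norm_fract_le b _).trans hbn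
    calc ‖w‖ = ‖√n • v - (√n • v - w)‖ := by rw [sub_sub_cancel]
      _ ≤ √n * ‖v‖ + ‖√n • v - w‖ := by
        refine (norm_sub_le _ _).trans_eq ?_
        rw [norm_smul, Real.norm_of_nonneg (Real.sqrt_nonneg _)]
      _ ≤ √n * (R - 1) + √n := by gcongr
      _ = √n * R := by ring
  have hwN (a : κ) : ∃ y : ℤ, w.1 a - countDeviation P n N₀ a = y := by
    obtain ⟨y, hy⟩ := (hb z).1 z.2 a
    exact ⟨-y, by simp [w, coe_typeOffset hN₀, hy]⟩
  have hwP (a : κ) : |w.1 a| < n * P a := by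
    have hwa : |w.1 a| ≤ √n * R := (PiLp.norm_apply_le w.1 a).trans hwR
    have hpPn : n * p ≤ n * P a := mul_le_mul_of_nonneg_left (hpP a) n.cast_nonneg
    linarith
  obtain ⟨N, hN, hNw⟩ := exists_mem_types_countDeviation_eq hT hP1 w.2 hwN hwP
  have hoffset : typeOffset T P n N = w := Subtype.ext ((coe_typeOffset hN).trans hNw)
  exact ⟨N, hN, hNw ▸ hwR, by rwa [typeCell, Set.mem_ofPred_eq, hoffset]⟩

end TypeCells

section Tails

variable {κ : Type*} [Fintype κ] {P : EuclideanSpace ℝ κ} {n : ℕ}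

theorem add_inv_sqrt_smul_pos {u v : EuclideanSpace ℝ κ} {p R ρ : ℝ} (hn : 0 < n) (hp : 0 < p)
    (hpP : ∀ a, p ≤ P a) (hR : 1 ≤ R) (hu : ‖u‖ ≤ √n * R) (hvu : ‖√n • v - u‖ ≤ ρ)
    (hρ : ρ ≤ √n) (hRn : 4 * (√n * R) ≤ p * n) (a : κ) : 0 < (P + (√n)⁻¹ • v) a := by
  have hn' : (0 : ℝ) < n := Nat.cast_pos.2 hn
  have hs : 0 < √(n : ℝ) := Real.sqrt_pos.2 hn'
  have hns : √(n : ℝ) ^ 2 = n := Real.sq_sqrt n.cast_nonneg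
  have hscaled : √n * |v a| ≤ p * n / 2 := by
    calc √n * |v a| = ‖(√n • v) a‖ := by
          rw [PiLp.smul_apply, norm_smul, Real.norm_of_nonneg hs.le, Real.norm_eq_abs]
      _ ≤ ‖u + (√n • v - u)‖ := by
          rw [add_sub_cancel]
          exact PiLp.norm_apply_le _ a
      _ ≤ √n * R + √n := (norm_add_le _ _).trans (add_le_add hu (hvu.trans hρ))
      _ ≤ p * n / 2 := by linarith [le_mul_of_one_le_right hs.le hR]
  have hsmall : |(√n)⁻¹ * v a| ≤ p / 2 := by
    rw [abs_mul, abs_inv, abs_of_pos hs, inv_mul_le_iff₀ hs]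
    refine le_of_mul_le_mul_left (hscaled.trans_eq ?_) hs
    linear_combination -(p / 2) * hns
  rw [PiLp.add_apply, PiLp.smul_apply, smul_eq_mul]
  linarith [hpP a, (abs_le.1 hsmall).1]

theorem sum_typeWeight_le_of_far [DecidableEq κ] {T : Submodule ℝ (EuclideanSpace ℝ κ)} {p R : ℝ}
    (hn : 0 < n) (hp : 0 < p) (hpP : ∀ a, p ≤ P a) (hP1 : ∑ a, P a = 1) (hR : 0 ≤ R)
    {t : Finset (κ → ℕ)} (ht : t ⊆ types T P n)
    (hfar : ∀ N ∈ t, √n * R ≤ ‖countDeviation P n N‖) :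
    ∑ N ∈ t, typeWeight P N ≤ (n + 1) ^ Fintype.card κ * (Real.exp (logCentralWeight P n) *
      Real.exp (Fintype.card κ / 2 * Real.log n - p / 4 * R ^ 2)) := by
  have hn' : (0 : ℝ) < n := Nat.cast_pos.2 hn
  have hterm (N : κ → ℕ) (hN : N ∈ t) : typeWeight P N ≤ Real.exp (logCentralWeight P n) *
      Real.exp (Fintype.card κ / 2 * Real.log n - p / 4 * R ^ 2) := by
    obtain ⟨hsum, hpos, -⟩ := mem_types.1 (ht hN)
    refine (typeWeight_le hp hpP hP1 hn hsum hpos).trans ?_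
    gcongr
    rw [le_div_iff₀ hn']
    calc R ^ 2 * n = (√n * R) ^ 2 := by rw [mul_pow, Real.sq_sqrt hn'.le, mul_comm]
      _ ≤ ‖countDeviation P n N‖ ^ 2 := pow_le_pow_left₀ (by positivity) (hfar N hN) 2
  refine (sum_le_card_nsmul _ _ _ hterm).trans ?_
  rw [nsmul_eq_mul]
  gcongr
  exact_mod_cast (card_le_card ht).trans (card_types_le T P n)

theorem setIntegral_gaussianKernel_le_of_far (hP : ∀ a, 0 < P a) (hP1 : ∀ a, P a ≤ 1)
    {T : Submodule ℝ (EuclideanSpace ℝ κ)} {U : Set T} (hU : MeasurableSet U) {r : ℝ} (hr : 0 ≤ r)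
    (hfar : ∀ v ∈ U, r ≤ ‖v‖) :
    ∫ v in U, gaussianKernel P v ≤
      Real.exp (-(1 / 4) * r ^ 2) * ∫ v : T, Real.exp (-(1 / 4) * ‖v‖ ^ 2) := by
  have hint : Integrable fun v : T => Real.exp (-(1 / 4) * ‖v‖ ^ 2) :=
    integrable_exp_neg_mul_sq_norm (by norm_num)
  calc ∫ v in U, gaussianKernel P v
      ≤ ∫ v in U, Real.exp (-(1 / 4) * r ^ 2) * Real.exp (-(1 / 4) * ‖v‖ ^ 2) := by
        refine setIntegral_mono_on (integrable_gaussianKernel hP hP1 T).integrableOn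
          (hint.integrableOn.const_mul _) hU fun v hv => (gaussianKernel_le hP hP1 v).trans ?_
        rw [← Real.exp_add, Real.exp_le_exp, Submodule.norm_coe]
        linarith [pow_le_pow_left₀ hr (hfar v hv) 2]
    _ = Real.exp (-(1 / 4) * r ^ 2) * ∫ v in U, Real.exp (-(1 / 4) * ‖v‖ ^ 2) :=
        integral_const_mul _ _
    _ ≤ Real.exp (-(1 / 4) * r ^ 2) * ∫ v : T, Real.exp (-(1 / 4) * ‖v‖ ^ 2) :=
        mul_le_mul_of_nonneg_left
          (setIntegral_le_integral hint (.of_forall fun v => (Real.exp_pos _).le))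
          (Real.exp_pos _).le

end Tails

theorem mul_integral_exp_le_mul_integral_gaussianKernel {κ : Type*} [Fintype κ]
    {P : EuclideanSpace ℝ κ} {p c ε : ℝ} (hp : 0 < p) (hpP : ∀ a, p ≤ P a) (hP1 : ∀ a, P a ≤ 1)
    (T : Submodule ℝ (EuclideanSpace ℝ κ)) (hc : 0 ≤ c) (hcε : c ≤ ε) :
    c * ∫ v : T, Real.exp (-(1 / (2 * p)) * ‖v‖ ^ 2) ≤ ε * ∫ v : T, gaussianKernel P v :=
  mul_le_mul hcε (integral_mono (integrable_exp_neg_mul_sq_norm (by positivity))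
    (integrable_gaussianKernel (fun a => hp.trans_le (hpP a)) hP1 T)
    fun v => le_gaussianKernel hp hpP v.1) (by positivity) (hc.trans hcε)

section CentralTypes

variable {κ ι : Type*} [Fintype κ] [Fintype ι] {T : Submodule ℝ (EuclideanSpace ℝ κ)}
  {P : EuclideanSpace ℝ κ} {p R ε : ℝ} {n : ℕ}

/-- The types whose cells are used in the Riemann sum: those within `√n R` of `n P`. -/
def centralTypes [DecidableEq κ] (T : Submodule ℝ (EuclideanSpace ℝ κ)) (P : EuclideanSpace ℝ κ)
    (n : ℕ) (R : ℝ) : Finset (κ → ℕ) :=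
  {N ∈ types T P n | ‖countDeviation P n N‖ ≤ √n * R}

/-- The sample size `n` is large enough for the local limit theorem to hold, over the lattice
spanned by `b` and for laws bounded below by `p`, up to the relative error `R ^ 3 / √n` on the ball
of radius `R` and up to the mass `1 / √n` outside it. -/
structure IsLargeSample (b : Module.Basis ι ℝ T) (p R : ℝ) (n : ℕ) : Prop where
  pos : 0 < n
  one_le : 1 ≤ R
  sum_norm_le : ∑ i, ‖b i‖ ≤ √n
  four_mul_le : 4 * (√n * R) ≤ p * n
  localLimitConst_mul_le : localLimitConst (Fintype.card κ) p (∑ i, ‖b i‖) * (R ^ 3 / √n) ≤ 1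
  typeTail_le : volume.real (ZSpan.fundamentalDomain b) * ((n + 1) ^ Fintype.card κ *
    Real.exp (Fintype.card κ / 2 * Real.log n - p / 4 * R ^ 2)) ≤
      (√n)⁻¹ * ∫ v : T, Real.exp (-(1 / (2 * p)) * ‖v‖ ^ 2)
  gaussianTail_le : Real.exp (-(1 / 4) * (R - 1) ^ 2) * ∫ v : T, Real.exp (-(1 / 4) * ‖v‖ ^ 2) ≤
    (√n)⁻¹ * ∫ v : T, Real.exp (-(1 / (2 * p)) * ‖v‖ ^ 2)

theorem IsLargeSample.two_mul_le {b : Module.Basis ι ℝ T} (hL : IsLargeSample b p R n) :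
    2 * (√n * R) ≤ p * n := by
  have hR : 0 ≤ √n * R := mul_nonneg (Real.sqrt_nonneg _) (zero_le_one.trans hL.one_le)
  linarith [hL.four_mul_le]

variable [DecidableEq κ]

theorem mem_centralTypes {N : κ → ℕ} :
    N ∈ centralTypes T P n R ↔ N ∈ types T P n ∧ ‖countDeviation P n N‖ ≤ √n * R :=
  mem_filter

theorem centralTypes_subset : centralTypes T P n R ⊆ types T P n :=
  filter_subset _ _

theorem IsLargeSample.mul_sum_typeWeight_sdiff_le {b : Module.Basis ι ℝ T}
    (hL : IsLargeSample b p R n) (hp : 0 < p) (hpP : ∀ a, p ≤ P a) (hP1 : ∑ a, P a = 1)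
    (hPle : ∀ a, P a ≤ 1) (hε : (√n)⁻¹ ≤ ε) :
    (√n ^ Module.finrank ℝ T)⁻¹ * volume.real (ZSpan.fundamentalDomain b) *
        ∑ N ∈ types T P n \ centralTypes T P n R, typeWeight P N ≤
      ε * (Real.exp (logCentralWeight P n) * ∫ v : T, gaussianKernel P v) := by
  have hfar : ∑ N ∈ types T P n \ centralTypes T P n R, typeWeight P N ≤ _ :=
    sum_typeWeight_le_of_far hL.pos hp hpP hP1 (zero_le_one.trans hL.one_le) sdiff_subset
      fun N hN => le_of_not_ge fun h =>
        (mem_sdiff.1 hN).2 (mem_centralTypes.2 ⟨(mem_sdiff.1 hN).1, h⟩)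
  have hcell : (√n ^ Module.finrank ℝ T)⁻¹ * volume.real (ZSpan.fundamentalDomain b) ≤
      volume.real (ZSpan.fundamentalDomain b) :=
    mul_le_of_le_one_left measureReal_nonneg
      (inv_le_one_of_one_le₀ (one_le_pow₀ (Real.one_le_sqrt.2 (Nat.one_le_cast.2 hL.pos))))
  calc _ ≤ volume.real (ZSpan.fundamentalDomain b) * _ :=
        mul_le_mul hcell hfar
          (sum_nonneg fun N _ => (typeWeight_pos (fun a => hp.trans_le (hpP a)) N).le)
          measureReal_nonneg
    _ = Real.exp (logCentralWeight P n) * (volume.real (ZSpan.fundamentalDomain b) *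
          ((n + 1) ^ Fintype.card κ *
            Real.exp (Fintype.card κ / 2 * Real.log n - p / 4 * R ^ 2))) := by ring
    _ ≤ Real.exp (logCentralWeight P n) * (ε * ∫ v : T, gaussianKernel P v) :=
        mul_le_mul_of_nonneg_left
          (hL.typeTail_le.trans (mul_integral_exp_le_mul_integral_gaussianKernel hp hpP hPle T
          (by positivity) hε)) (Real.exp_pos _).le
    _ = _ := by ring

theorem IsLargeSample.setIntegral_compl_typeCell_le (hT : ∀ v ∈ T, ∑ a, v a = 0)
    {b : Module.Basis ι ℝ T}
    (hb : ∀ v : T, v ∈ Submodule.span ℤ (Set.range b) ↔ ∀ a, ∃ z : ℤ, v.1 a = z)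
    (hL : IsLargeSample b p R n) (hp : 0 < p) (hpP : ∀ a, p ≤ P a) (hP1 : ∑ a, P a = 1)
    (hPle : ∀ a, P a ≤ 1) (hne : (types T P n).Nonempty) (hε : (√n)⁻¹ ≤ ε) :
    ∫ v in (⋃ N ∈ centralTypes T P n R, typeCell b P n N)ᶜ, gaussianKernel P v ≤
      ε * ∫ v : T, gaussianKernel P v := by
  have hmeas : MeasurableSet (⋃ N ∈ centralTypes T P n R, typeCell b P n N) :=
    Finset.measurableSet_biUnion _ fun N _ => measurableSet_typeCell b P n N
  refine (setIntegral_gaussianKernel_le_of_far (fun a => hp.trans_le (hpP a)) hPle hmeas.compl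
    (sub_nonneg.2 hL.one_le) fun v hv => le_of_not_ge fun h => ?_).trans
    (hL.gaussianTail_le.trans (mul_integral_exp_le_mul_integral_gaussianKernel hp hpP hPle T
          (by positivity) hε))
  obtain ⟨N, hN, hNR, hvN⟩ :=
    exists_mem_typeCell hT hb hp hpP hP1 hL.pos hne hL.sum_norm_le hL.two_mul_le h
  exact hv (Set.mem_biUnion (mem_centralTypes.2 ⟨hN, hNR⟩) hvN)

theorem IsLargeSample.isCellApproximation (hT : ∀ v ∈ T, ∑ a, v a = 0) {b : Module.Basis ι ℝ T}
    (hb : ∀ v : T, v ∈ Submodule.span ℤ (Set.range b) ↔ ∀ a, ∃ z : ℤ, v.1 a = z)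
    (hL : IsLargeSample b p R n) (hp : 0 < p) (hpP : ∀ a, p ≤ P a) (hP1 : ∑ a, P a = 1)
    (hne : (types T P n).Nonempty) (hε : (√n)⁻¹ ≤ ε)
    (hlocal : 2 * (localLimitConst (Fintype.card κ) p (∑ i, ‖b i‖) * (R ^ 3 / √n)) ≤ ε) :
    IsCellApproximation volume (types T P n) (centralTypes T P n R) (typeWeight P) (typeCell b P n)
      (fun v : T => Real.exp (logCentralWeight P n) * gaussianKernel P v)
      ((√n ^ Module.finrank ℝ T)⁻¹ * volume.real (ZSpan.fundamentalDomain b)) ε := by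
  have hP (a : κ) : 0 < P a := hp.trans_le (hpP a)
  have hPle : ∀ a, P a ≤ 1 := le_one_of_sum_eq_one (fun a => (hP a).le) hP1
  have hG (v : T) : 0 ≤ Real.exp (logCentralWeight P n) * gaussianKernel P v :=
    mul_nonneg (Real.exp_pos _).le (gaussianKernel_pos P v).le
  have hF : 0 < volume.real (ZSpan.fundamentalDomain b) :=
    ENNReal.toReal_pos (ZSpan.measure_fundamentalDomain_ne_zero b)
      (ZSpan.fundamentalDomain_isBounded b).measure_lt_top.ne
  have hs : 0 < √(n : ℝ) := Real.sqrt_pos.2 (Nat.cast_pos.2 hL.pos)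
  refine
    { subset := centralTypes_subset
      weight_nonneg := fun N _ => (typeWeight_pos hP N).le
      integrable := (integrable_gaussianKernel hP hPle T).const_mul _
      density_nonneg := hG
      measurableSet := fun N _ => measurableSet_typeCell b P n N
      pairwiseDisjoint :=
        (pairwiseDisjoint_typeCell hb P n).subset (coe_subset.2 centralTypes_subset)
      volume_pos := by positivity
      measureReal_eq := fun N _ => volume_real_typeCell b P hL.pos N
      abs_weight_sub_le := fun N hN v hv => ?_
      sum_sdiff_le := ?_
      setIntegral_compl_le := ?_ }
  · obtain ⟨hN, hNR⟩ := mem_centralTypes.1 hN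
    exact (abs_typeWeight_sub_le hp hpP hP1 hL.pos (mem_types.1 hN).1 hL.one_le hNR hL.two_mul_le
      (norm_le_of_mem_typeCell hN hv) hL.sum_norm_le hL.localLimitConst_mul_le).trans
      (mul_le_mul_of_nonneg_right hlocal (hG v))
  · rw [integral_const_mul]
    exact hL.mul_sum_typeWeight_sdiff_le hp hpP hP1 hPle hε
  · rw [integral_const_mul, integral_const_mul, mul_left_comm]
    exact mul_le_mul_of_nonneg_left
      (hL.setIntegral_compl_typeCell_le hT hb hp hpP hP1 hPle hne hε) (Real.exp_pos _).le

end CentralTypes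

/-- The constant in the comparison of the average over types with the Gaussian average, over an
alphabet of `c` letters each of weight at least `p` and a lattice with cells of diameter `ρ`. -/
def averageConst (c : ℕ) (p ρ : ℝ) : ℝ :=
  2 * localLimitConst c p ρ + samplingConst c p ρ + 1

section AverageConst

variable {c : ℕ} {p ρ x : ℝ}

theorem two_mul_localLimitConst_mul_le (hp : 0 < p) (hρ : 0 ≤ ρ) (hx : 0 ≤ x) :
    2 * (localLimitConst c p ρ * x) ≤ averageConst c p ρ * x := by
  have hsampling : 0 ≤ samplingConst c p ρ := by unfold samplingConst; positivity
  rw [← mul_assoc, averageConst]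
  exact mul_le_mul_of_nonneg_right (by linarith) hx

theorem samplingConst_mul_le (hp : 0 < p) (hρ : 0 ≤ ρ) (hx : 0 ≤ x) :
    samplingConst c p ρ * x ≤ averageConst c p ρ * x := by
  have hlocal : 0 ≤ localLimitConst c p ρ := by unfold localLimitConst; positivity
  rw [averageConst]
  exact mul_le_mul_of_nonneg_right (by linarith) hx

theorem le_averageConst_mul (hp : 0 < p) (hρ : 0 ≤ ρ) (hx : 0 ≤ x) :
    x ≤ averageConst c p ρ * x := by
  have hsampling : 0 ≤ samplingConst c p ρ := by unfold samplingConst; positivity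
  have hlocal : 0 ≤ localLimitConst c p ρ := by unfold localLimitConst; positivity
  exact le_mul_of_one_le_left hx (by rw [averageConst]; linarith)

end AverageConst

section PredictiveLaw

variable {k n m : ℕ} {p R : ℝ} {ι : Type*} [Fintype ι] {T : Submodule ℝ (Vec k)} {P : Vec k}

theorem IsLargeSample.abs_withoutReplacementProb_sub_iidProb_le (hT : ∀ v ∈ T, ∑ a, v a = 0)
    {b : Module.Basis ι ℝ T} (hL : IsLargeSample b p R n) (hp : 0 < p) (hpP : ∀ a, p ≤ P a)
    (hP1 : ∑ a, P a = 1) (hmn : m ≤ n) (hm : m ^ 2 ≤ n) {N : Fin k → ℕ}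
    (hN : N ∈ centralTypes T P n R) {v : T} (hv : v ∈ typeCell b P n N)
    (hPv : ∀ a, 0 ≤ (P + (√n)⁻¹ • v.1) a) (A : Set (Fin m → Fin k)) :
    |withoutReplacementProb hmn N A - iidProb (P + (√n)⁻¹ • v.1) m A| ≤
      samplingConst k p (∑ i, ‖b i‖) * (R ^ 3 / √n) := by
  obtain ⟨hN, hNR⟩ := mem_centralTypes.1 hN
  have hs : 0 < √(n : ℝ) := Real.sqrt_pos.2 (Nat.cast_pos.2 hL.pos)
  have hms : m ≤ √(n : ℝ) := Real.le_sqrt_of_sq_le (by exact_mod_cast hm)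
  have hmp : 4 * m ≤ p * n := by
    linarith [hL.four_mul_le, le_mul_of_one_le_right hs.le hL.one_le]
  have hmR : (m : ℝ) / n ≤ R ^ 3 / √n := by
    calc (m : ℝ) / n ≤ √n / n := by gcongr
      _ = 1 / √n := Real.sqrt_div_self'
      _ ≤ R ^ 3 / √n := by gcongr; exact one_le_pow₀ hL.one_le
  refine (TiltedDeFinetti.abs_withoutReplacementProb_sub_iidProb_le hmn hp hpP hP1 hL.pos
    (mem_types.1 hN).1 hNR hL.two_mul_le (hT v v.2) hPv (norm_le_of_mem_typeCell hN hv) hm hmp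
    A).trans (mul_le_mul_of_nonneg_left hmR ?_)
  unfold samplingConst
  positivity

theorem IsLargeSample.abs_average_types_sub_le (hT : ∀ v ∈ T, ∑ a, v a = 0)
    {b : Module.Basis ι ℝ T}
    (hb : ∀ v : T, v ∈ Submodule.span ℤ (Set.range b) ↔ ∀ a, ∃ z : ℤ, v.1 a = z)
    (hL : IsLargeSample b p R n) (hp : 0 < p) (hpP : ∀ a, p ≤ P a) (hP1 : ∑ a, P a = 1)
    (hne : (types T P n).Nonempty) (hmn : m ≤ n) (hm : m ^ 2 ≤ n) (A : Set (Fin m → Fin k))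
    {π : T → ℝ} (hπ : Continuous π) (hπ01 : ∀ v, π v ∈ Set.Icc 0 1)
    (hπA : ∀ v : T, (∀ a, 0 < (P + (√n)⁻¹ • v.1) a) → π v = iidProb (P + (√n)⁻¹ • v.1) m A) :
    |(∑ N ∈ types T P n, typeWeight P N * withoutReplacementProb hmn N A) /
          ∑ N ∈ types T P n, typeWeight P N -
        (∫ v : T, π v * gaussianKernel P v) / ∫ v : T, gaussianKernel P v| ≤
      8 * (averageConst k p (∑ i, ‖b i‖) * (R ^ 3 / √n)) := by
  have hP (a : Fin k) : 0 < P a := hp.trans_le (hpP a)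
  have hPle : ∀ a, P a ≤ 1 := le_one_of_sum_eq_one (fun a => (hP a).le) hP1
  have hρ : 0 ≤ ∑ i, ‖b i‖ := by positivity
  have hRs : (√n)⁻¹ ≤ R ^ 3 / √n := by
    rw [inv_eq_one_div]
    gcongr
    exact one_le_pow₀ hL.one_le
  have hRs0 : 0 ≤ R ^ 3 / √n := (by positivity : 0 ≤ (√n)⁻¹).trans hRs
  have hcells := hL.isCellApproximation hT hb hp hpP hP1 hne
    (hRs.trans (le_averageConst_mul (c := k) hp hρ hRs0))
    (by rw [Fintype.card_fin]; exact two_mul_localLimitConst_mul_le hp hρ hRs0)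
  have haverage := hcells.abs_average_sub_average_le (hRs0.trans (le_averageConst_mul hp hρ hRs0))
    (sum_pos (fun N _ => typeWeight_pos hP N) hne)
    (by
      rw [integral_const_mul]
      exact mul_pos (Real.exp_pos _) (integral_gaussianKernel_pos hP hPle T))
    (γ := fun N => withoutReplacementProb hmn N A)
    (fun N => ⟨withoutReplacementProb_nonneg hmn A, withoutReplacementProb_le_one hmn A⟩)
    hπ.aestronglyMeasurable hπ01 fun N hN v hv => by
      obtain ⟨hNT, hNR⟩ := mem_centralTypes.1 hN
      have hPv := add_inv_sqrt_smul_pos hL.pos hp hpP hL.one_le hNR (norm_le_of_mem_typeCell hNT hv)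
        hL.sum_norm_le hL.four_mul_le
      rw [hπA v hPv]
      exact (hL.abs_withoutReplacementProb_sub_iidProb_le hT hp hpP hP1 hmn hm hN hv
        (fun a => (hPv a).le) A).trans (samplingConst_mul_le hp hρ hRs0)
  simp only [mul_left_comm _ (Real.exp _), integral_const_mul] at haverage
  rwa [mul_div_mul_left _ _ (Real.exp_ne_zero _)] at haverage

end PredictiveLaw

section LargeSampleSizes

open Filter Topology

theorem tendsto_log_pow_div_sqrt (j : ℕ) :
    Tendsto (fun n : ℕ => Real.log n ^ j / √n) atTop (𝓝 0) := by
  have hlog := (isLittleO_log_rpow_rpow_atTop (j : ℝ)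
    (by norm_num : (0 : ℝ) < 1 / 2)).tendsto_div_nhds_zero
  refine (hlog.comp tendsto_natCast_atTop_atTop).congr fun n => ?_
  simp [Real.sqrt_eq_rpow]

theorem sqrt_eq_exp_half_log {x : ℝ} (hx : 0 < x) : √x = Real.exp (1 / 2 * Real.log x) := by
  rw [mul_comm, Real.exp_mul, Real.exp_log hx, Real.sqrt_eq_rpow]

theorem tendsto_exp_mul_log_sub_mul_log_sq {a : ℝ} (ha : 0 < a) (c : ℝ) :
    Tendsto (fun n : ℕ => Real.exp (c * Real.log n - a * Real.log n ^ 2)) atTop (𝓝 0) := by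
  have hquadratic : Tendsto (fun x : ℝ => x * (a * x - c)) atTop atTop :=
    tendsto_id.atTop_mul_atTop₀ (tendsto_atTop_add_const_right _ _ (tendsto_id.const_mul_atTop ha))
  refine Real.tendsto_exp_atBot.comp ((tendsto_neg_atTop_atBot.comp (hquadratic.comp
    (Real.tendsto_log_atTop.comp tendsto_natCast_atTop_atTop))).congr fun n => ?_)
  simp only [Function.comp_apply]
  ring

theorem eventually_mul_exp_le_inv_sqrt_mul {a y : ℝ} (ha : 0 < a) (hy : 0 < y) (c x : ℝ) :
    ∀ᶠ n : ℕ in atTop, x * Real.exp (c * Real.log n - a * Real.log n ^ 2) ≤ (√n)⁻¹ * y := by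
  have htendsto := (tendsto_exp_mul_log_sub_mul_log_sq ha (1 / 2 + c)).const_mul x
  rw [mul_zero] at htendsto
  filter_upwards [htendsto.eventually (ge_mem_nhds hy), eventually_gt_atTop 0] with n hn hn0
  have hn0 : (0 : ℝ) < n := Nat.cast_pos.2 hn0
  rw [le_inv_mul_iff₀ (Real.sqrt_pos.2 hn0), sqrt_eq_exp_half_log hn0, mul_left_comm,
    ← Real.exp_add]
  convert hn using 3
  ring

theorem eventually_sq_le_of_le_mul_rpow {η : ℝ} (hη : η < 1 / 2) (c : ℝ) :
    ∀ᶠ n : ℕ in atTop, ∀ m : ℕ, m ≤ c * (n : ℝ) ^ η → m ^ 2 ≤ n := by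
  have htendsto := ((tendsto_rpow_neg_atTop (sub_pos.2 hη)).comp
    (tendsto_natCast_atTop_atTop (R := ℝ))).const_mul c
  rw [mul_zero] at htendsto
  filter_upwards [htendsto.eventually (ge_mem_nhds zero_lt_one), eventually_gt_atTop 0]
    with n hn hn0 m hm
  have hn0 : (0 : ℝ) < n := Nat.cast_pos.2 hn0
  have hsqrt : (m : ℝ) ≤ √n :=
    calc (m : ℝ) ≤ c * (n : ℝ) ^ (-(1 / 2 - η)) * √n := by
          rw [Real.sqrt_eq_rpow, mul_assoc, ← Real.rpow_add hn0]
          convert hm using 3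
          ring
      _ ≤ √n := mul_le_of_le_one_left (Real.sqrt_nonneg _) hn
  exact_mod_cast (Real.le_sqrt m.cast_nonneg hn0.le).1 hsqrt

theorem add_one_pow_le_two_pow_mul_exp {n : ℕ} (hn : 0 < n) (c : ℕ) :
    ((n : ℝ) + 1) ^ c ≤ 2 ^ c * Real.exp (c * Real.log n) := by
  have hn : (1 : ℝ) ≤ n := Nat.one_le_cast.2 hn
  rw [Real.exp_nat_mul, Real.exp_log (by linarith), ← mul_pow]
  exact pow_le_pow_left₀ (by linarith) (by linarith) c

theorem eventually_typeTail_le {p y : ℝ} (hp : 0 < p) (hy : 0 < y) (c : ℕ) {x : ℝ} (hx : 0 ≤ x) :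
    ∀ᶠ n : ℕ in atTop, x * (((n : ℝ) + 1) ^ c *
      Real.exp (c / 2 * Real.log n - p / 4 * Real.log n ^ 2)) ≤ (√n)⁻¹ * y := by
  filter_upwards [eventually_mul_exp_le_inv_sqrt_mul (by positivity : 0 < p / 4) hy (c + c / 2)
    (x * 2 ^ c), eventually_gt_atTop 0] with n hn hn0
  refine le_trans ?_ hn
  calc x * (((n : ℝ) + 1) ^ c * Real.exp (c / 2 * Real.log n - p / 4 * Real.log n ^ 2))
      ≤ x * (2 ^ c * Real.exp (c * Real.log n) *
          Real.exp (c / 2 * Real.log n - p / 4 * Real.log n ^ 2)) := by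
        gcongr
        exact add_one_pow_le_two_pow_mul_exp hn0 c
    _ = x * 2 ^ c * Real.exp ((c + c / 2) * Real.log n - p / 4 * Real.log n ^ 2) := by
        rw [mul_assoc (2 ^ c), ← Real.exp_add, ← mul_assoc]
        congr 2
        ring

theorem eventually_gaussianTail_le {y : ℝ} (hy : 0 < y) (x : ℝ) :
    ∀ᶠ n : ℕ in atTop, Real.exp (-(1 / 4) * (Real.log n - 1) ^ 2) * x ≤ (√n)⁻¹ * y := by
  filter_upwards [eventually_mul_exp_le_inv_sqrt_mul (by norm_num : (0 : ℝ) < 1 / 4) hy (1 / 2)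
    (x * Real.exp (-(1 / 4)))] with n hn
  refine hn.trans_eq' ?_
  rw [mul_assoc, ← Real.exp_add, mul_comm]
  congr 2
  ring

theorem eventually_isLargeSample {κ ι : Type*} [Fintype κ] [Fintype ι]
    {T : Submodule ℝ (EuclideanSpace ℝ κ)} (b : Module.Basis ι ℝ T) {p : ℝ} (hp : 0 < p) :
    ∀ᶠ n : ℕ in atTop, IsLargeSample b p (Real.log n) n := by
  have hcast := tendsto_natCast_atTop_atTop (R := ℝ)
  have hintegral : 0 < ∫ v : T, Real.exp (-(1 / (2 * p)) * ‖v‖ ^ 2) := by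
    rw [GaussianFourier.integral_rexp_neg_mul_sq_norm (by positivity)]
    positivity
  have hradius := (tendsto_log_pow_div_sqrt 1).const_mul 4
  have hlocal := (tendsto_log_pow_div_sqrt 3).const_mul
    (localLimitConst (Fintype.card κ) p (∑ i, ‖b i‖))
  rw [mul_zero] at hradius hlocal
  filter_upwards [eventually_gt_atTop 0,
    (Real.tendsto_log_atTop.comp hcast).eventually_ge_atTop 1,
    (Real.tendsto_sqrt_atTop.comp hcast).eventually_ge_atTop (∑ i, ‖b i‖),
    hradius.eventually (ge_mem_nhds hp), hlocal.eventually (ge_mem_nhds zero_lt_one),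
    eventually_typeTail_le hp hintegral (Fintype.card κ)
      (measureReal_nonneg (μ := volume) (s := ZSpan.fundamentalDomain b)),
    eventually_gaussianTail_le hintegral (∫ v : T, Real.exp (-(1 / 4) * ‖v‖ ^ 2))]
    with n hn hlog hsqrt hradius hlocal htype hgauss
  refine ⟨hn, hlog, hsqrt, ?_, hlocal, htype, hgauss⟩
  calc 4 * (√n * Real.log n) = 4 * (Real.log n ^ 1 / √n) * n := by
        rw [← mul_div_assoc, div_mul_eq_mul_div, mul_div_assoc, Real.div_sqrt]
        ring
    _ ≤ p * n := mul_le_mul_of_nonneg_right hradius n.cast_nonneg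

end LargeSampleSizes

section Comparison

variable {k d n m : ℕ} {Q P : Vec k} {h : Fin k → Fin d → ℝ} {α : Fin d → ℝ}

theorem tangentSpace_eq_range_projectedHessian (h : Fin k → Fin d → ℝ) (hP : ∀ a, 0 < P a) :
    tangentSpace h = LinearMap.range (projectedHessian h P) := by
  have hinj : Function.Injective (tangentHessian h P) := by
    refine (injective_iff_map_eq_zero _).2 fun w hw => by_contra fun hw0 => ?_
    simpa [hw] using inner_tangentHessian_self_pos h hP hw0
  refine le_antisymm (fun v hv => ?_) ?_
  · obtain ⟨w, hw⟩ := LinearMap.injective_iff_surjective.1 hinj ⟨v, hv⟩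
    exact ⟨w, congrArg Subtype.val hw⟩
  · rintro _ ⟨w, rfl⟩
    exact projectedHessian_mem h P w

theorem iidProb_localChart_mem_Icc (hP : P ∈ feasible h α) (n : ℕ) (A : Set (Fin m → Fin k))
    (v : tangentSpace h) : iidProb (localChart h α P n v) m A ∈ Set.Icc 0 1 := by
  obtain ⟨hnonneg, hsum, -⟩ := localChart_mem_closedFeasible hP n v
  exact ⟨iidProb_nonneg hnonneg m A, iidProb_le_one hsum hnonneg m A⟩

theorem integrable_iidProb_mul_gaussianDensity (hP : P ∈ feasible h α) (n : ℕ)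
    (A : Set (Fin m → Fin k)) :
    Integrable (fun v => iidProb (localChart h α P n v) m A * gaussianDensity h P v)
      (tangentLebesgue h) := by
  have hdensity : Integrable (gaussianDensity h P) := by
    simp only [funext (gaussianDensity_eq h hP.1.1)]
    exact (integrable_gaussianKernel hP.1.1
      (le_one_of_sum_eq_one (fun a => (hP.1.1 a).le) hP.1.2) _).const_mul _
  rw [tangentLebesgue_eq_volume]
  refine hdensity.bdd_mul (c := 1)
    ((continuous_iidProb m A).comp (continuous_localChart hP n)).aestronglyMeasurable
    (.of_forall fun v => ?_)
  obtain ⟨hnonneg, hle⟩ := iidProb_localChart_mem_Icc hP n A v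
  rwa [Real.norm_of_nonneg hnonneg]

theorem integral_iidProb_mul_gaussianDensity (hP : ∀ a, 0 < P a) (A : Set (Fin m → Fin k)) :
    ∫ v, iidProb (localChart h α P n v) m A * gaussianDensity h P v ∂(tangentLebesgue h) =
      (∫ v : tangentSpace h, iidProb (localChart h α P n v) m A * gaussianKernel P v) /
        ∫ v : tangentSpace h, gaussianKernel P v := by
  rw [tangentLebesgue_eq_volume, ← integral_div]
  simp only [gaussianDensity_eq h hP, inv_mul_eq_div, mul_div_assoc]

theorem IsIProjection.abs_predictiveLaw_sub_integral_le {ι : Type*} [Fintype ι] {p R : ℝ}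
    (hQ : Q ∈ openSimplex k) (hP : IsIProjection Q h α P) (hp : 0 < p) (hpP : ∀ a, p ≤ P a)
    {b : Module.Basis ι ℝ (tangentSpace h)}
    (hb : ∀ v : tangentSpace h,
      v ∈ Submodule.span ℤ (Set.range b) ↔ ∀ a, ∃ z : ℤ, v.1 a = z)
    (hL : IsLargeSample b p R n) (hmn : m ≤ n) (hm : m ^ 2 ≤ n)
    (hne : (constraintEvent h α n).Nonempty) (A : Set (Fin m → Fin k)) :
    |predictiveLaw Q h α hmn A -
        ∫ v, iidProb (localChart h α P n v) m A * gaussianDensity h P v ∂(tangentLebesgue h)| ≤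
      8 * (averageConst k p (∑ i, ‖b i‖) * (R ^ 3 / √n)) := by
  obtain ⟨x, hx⟩ := hne
  rw [hP.predictiveLaw_eq_sum_types hQ hL.pos, integral_iidProb_mul_gaussianDensity hP.1.1.1]
  exact hL.abs_average_types_sub_le (fun v (hv : v ∈ tangentSpace h) => hv.1) hb hp hpP hP.1.1.2
    ⟨_, (mem_constraintEvent_iff hP.1 hL.pos).1 hx⟩ hmn hm A
    ((continuous_iidProb m A).comp (continuous_localChart hP.1 n))
    (iidProb_localChart_mem_Icc hP.1 n A)
    fun v hv => by rw [localChart_eq_add_smul hP.1 n v hv]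

end Comparison

end TiltedDeFinetti

end

open TiltedDeFinetti in
theorem theorem1_general {k : ℕ} (T : Submodule ℝ (Vec k)) (p : ℝ) :
    ∃ (C : ℝ) (n₀ : ℕ), ∀ {d : ℕ} (Q : Vec k) (h : Fin k → Fin d → ℝ) (α : Fin d → ℝ)
      (Pstar : Vec k),
      Q ∈ openSimplex k →
      HasFullTypeLattice h →
      tangentSpace h = T →
      IsIProjection Q h α Pstar →
      0 < p →
      (∀ x, p ≤ Pstar x) →
      ∀ (n m : ℕ) (hmn : m ≤ n), n₀ ≤ n → m ^ 2 ≤ n →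
        (constraintEvent h α n).Nonempty →
        ∀ A : Set (Fin m → Fin k),
          Integrable
            (fun v : tangentSpace h =>
              iidProb (localChart h α Pstar n v) m A * gaussianDensity h Pstar v)
            (tangentLebesgue h) ∧
          |predictiveLaw Q h α hmn A -
              ∫ v : tangentSpace h,
                iidProb (localChart h α Pstar n v) m A * gaussianDensity h Pstar v
                ∂(tangentLebesgue h)| ≤
            C * (n : ℝ) ^ (-(1 / 2) : ℝ) * Real.log n ^ 3 := by
  by_cases hpT : 0 < p ∧ Submodule.span ℝ {v : Vec k | v ∈ T ∧ ∀ x, ∃ z : ℤ, v x = z} = T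
  · obtain ⟨hp, hT⟩ := hpT
    obtain ⟨r, b, hb⟩ := exists_basis_mem_span_int_iff hT
    obtain ⟨n₀, hn₀⟩ := Filter.eventually_atTop.1 (eventually_isLargeSample b hp)
    refine ⟨8 * averageConst k p (∑ i, ‖b i‖), n₀, ?_⟩
    rintro d Q h α Pstar hQ - rfl hP - hpP n m hmn hn hm hne A
    refine ⟨integrable_iidProb_mul_gaussianDensity hP.1 n A, ?_⟩
    refine (hP.abs_predictiveLaw_sub_integral_le hQ hp hpP hb (hn₀ n hn) hmn hm hne A).trans_eq ?_
    rw [Real.rpow_neg n.cast_nonneg, ← Real.sqrt_eq_rpow]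
    ring
  · refine ⟨0, 0, ?_⟩
    rintro d Q h α Pstar - hh rfl - hp
    exact absurd ⟨hp, hh⟩ hpT

open TiltedDeFinetti in
theorem theorem1 (k d : ℕ) (hk : 2 ≤ k) (pmin : ℝ) (H : Vec k →ₗ[ℝ] Vec k) :
    ∃ (C : ℝ) (L : ℕ), ∀ (η K : ℝ), η < 1 / 2 → ∃ n₀ : ℕ,
      ∀ (Q : Vec k) (h : Fin k → Fin d → ℝ) (α : Fin d → ℝ) (Pstar : Vec k),
        Q ∈ openSimplex k →
        HasFullTypeLattice h →
        IsIProjection Q h α Pstar →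
        IsLeast (Set.range fun x => Pstar x) pmin →
        projectedHessian h Pstar = H →
        ∀ (n m : ℕ) (hmn : m ≤ n), n₀ ≤ n → (m : ℝ) ≤ K * (n : ℝ) ^ η →
          (constraintEvent h α n).Nonempty →
          ∀ A : Set (Fin m → Fin k),
            MeasureTheory.Integrable
              (fun v : tangentSpace h =>
                iidProb (localChart h α Pstar n v) m A * gaussianDensity h Pstar v)
              (tangentLebesgue h) ∧
            |predictiveLaw Q h α hmn A -
                ∫ v : tangentSpace h,
                  iidProb (localChart h α Pstar n v) m A * gaussianDensity h Pstar v
                  ∂(tangentLebesgue h)| ≤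
              C * (n : ℝ) ^ (-(1 / 2) : ℝ) * Real.log n ^ L := by
  obtain ⟨C, n₀, hC⟩ := theorem1_general (LinearMap.range H) pmin
  refine ⟨C, 3, fun η K hη => ?_⟩
  obtain ⟨n₁, hn₁⟩ := Filter.eventually_atTop.1 (eventually_sq_le_of_le_mul_rpow hη K)
  refine ⟨max n₀ n₁, fun Q h α Pstar hQ hh hP hmin hH n m hmn hn hm => ?_⟩
  obtain ⟨x, hx⟩ := hmin.1
  exact hC Q h α Pstar hQ hh (hH ▸ tangentSpace_eq_range_projectedHessian h hP.1.1.1) hP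
    (hx ▸ hP.1.1.1 x) (fun y => hmin.2 ⟨y, rfl⟩) n m hmn (le_of_max_le_left hn)
    (hn₁ n (le_of_max_le_right hn) m hm)
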